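/- Conventions. Let $F$ be a field of characteristic $0$ with an automorphism $\sigma$ and a derivation $\partial$ commuting with $\sigma$. A $q$-difference module over $F$ is a finite-dimensional $F$-vector space $M$ with an invertible $\sigma$-semilinear operator $\Sigma$. For an $F$-vector space $V$, the prolongation $F_\partial(V)=F[\partial]_{\le 1}\otimes_F V$ consists of the formal sums $v_0+\partial(v_1)$ with $v_0,v_1\in V$ and left $F$-structure $\lambda\,\partial(v)=\partial(\lambda v)-\partial(\lambda)v$; linear maps, and the operator $\Sigma$, extend to it by $v_0+\partial(v_1)\mapsto \Sigma v_0+\partial(\Sigma v_1)$. The constructions of differential linear algebra of $M$ are the spaces obtained from $M$ by iterating direct sums, tensor products, symmetric and exterior powers, duals and $F_\partial$; each is again a $q$-difference module, and $\mathrm{GL}(M)$ acts on it by functoriality. The parameterized generic Galois group $Gal^\partial(M)$ is the functor which sends a commutative $F$-algebra $R$, equipped with a derivation extending that of $F$, to the group $Gal^\partial(M)(R)$ of all $g\in \mathrm{GL}(M\otimes_F R)$ that stabilize $N\otimes_F R$ for every sub-$q$-difference module $N$ of every construction of differential linear algebra of $M$. For an extension $L/F$ of such fields, $Gal^\partial(M)\otimes_F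 L$ is the restriction of this functor to differential $L$-algebras, a subgroup of $\mathrm{GL}(M\otimes_F L)$. Statement. Let $K\subset\mathbb C$ be a finitely generated field extension of $\mathbb Q$ and $q\in K$, $q\neq 0,1$. For every field $K\subset L\subset \mathbb C$ endow $L(x)$ with $\sigma_q:f(x)\mapsto f(qx)$ and $\partial=x\frac{d}{dx}$. Let $M_{K(x)}$ be a $q$-difference module over $K(x)$ and, for such $L$, let $M_{L(x)}=M_{K(x)}\otimes_{K(x)}L(x)$ with operator $f\otimes m\mapsto\sigma_q(f)\otimes\Sigma(m)$. Then, as subgroups of $\mathrm{GL}(M_{\mathbb C(x)})$, $$Gal^\partial(M_{\mathbb C(x)})\subset Gal^\partial(M_{K(x)})\otimes_{K(x)}\mathbb C(x).$$ Moreover, there is a finitely generated field extension $K'$ of $K$ in $\mathbb C$ such that, as subgroups of $\mathrm{GL}(M_{\mathbb C(x)})$, $$Gal^\partial(M_{K'(x)})\otimes_{K'(x)}\mathbb C(x)=Gal^\partial(M_{\mathbb C(x)}).$$ -/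

import Mathlib

open scoped Differential TensorProduct nonZeroDivisors

universe u v w x

/-! ### Differential rings and their morphisms -/

/-- A differential ring from an additive map satisfying the Leibniz rule. -/
@[reducible]
def Differential.ofFun {R : Type u} [CommRing R] (d : R → R) (hadd : ∀ a b, d (a + b) = d a + d b)
    (hmul : ∀ a b, d (a * b) = a * d b + b * d a) : Differential R where
  deriv := Derivation.mk' (AddMonoidHom.mk' d hadd).toIntLinearMap hmul

/-- A morphism of commutative differential rings. A commutative `∂`-`F`-algebra is a commutative
differential ring `R` together with a `DiffHom F R`. -/
structure DiffHom (R : Type u) (S : Type v) [CommRing R] [Differential R] [CommRing S]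
    [Differential S] extends R →+* S where
  map_deriv' : ∀ a : R, toRingHom (a′) = (toRingHom a)′

namespace DiffHom

variable {R : Type u} {S : Type v} {T : Type w} [CommRing R] [Differential R] [CommRing S]
  [Differential S] [CommRing T] [Differential T]

/-- The identity. -/
@[reducible]
def id (R : Type u) [CommRing R] [Differential R] : DiffHom R R where
  toRingHom := RingHom.id R
  map_deriv' _ := rfl

/-- Composition. -/
def comp (ψ : DiffHom S T) (φ : DiffHom R S) : DiffHom R T where
  toRingHom := ψ.toRingHom.comp φ.toRingHom
  map_deriv' a := by
    simp only [RingHom.comp_apply, φ.map_deriv', ψ.map_deriv']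

instance (ψ : DiffHom S T) (φ : DiffHom R S) :
    RingHomCompTriple φ.toRingHom ψ.toRingHom (ψ.comp φ).toRingHom := ⟨rfl⟩

end DiffHom

/-! ### The prolongation functor -/

/-- The prolongation `F_∂(V) = R[∂]_{≤ 1} ⊗_R V` of an `R`-module `V`. As a right `R`-module
`R[∂]_{≤ 1}` is free with basis `1, ∂`, so every element is uniquely of the form `v₀ + ∂(v₁)`; this
element is the pair `(v₀, v₁)`. -/
def Prolong (V : Type v) : Type v := V × V

namespace Prolong

instance (V : Type v) [AddCommGroup V] : AddCommGroup (Prolong V) :=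
  inferInstanceAs (AddCommGroup (V × V))

variable {R : Type u} [CommRing R] [Differential R] {V : Type v} [AddCommGroup V] [Module R V]

/-- The left module structure coming from the Leibniz rule `a ∂(v) = ∂(a v) - a′ v`. -/
instance : Module R (Prolong V) where
  smul a z := (a • z.1 - a′ • z.2, a • z.2)
  one_smul z := Prod.ext
    (show (1 : R) • z.1 - (1 : R)′ • z.2 = z.1 by simp)
    (show (1 : R) • z.2 = z.2 by simp)
  mul_smul a b z := Prod.ext
    (show (a * b) • z.1 - (a * b)′ • z.2 = a • (b • z.1 - b′ • z.2) - a′ • (b • z.2) by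
      rw [Derivation.leibniz, smul_sub, add_smul, smul_smul, smul_smul, smul_smul, smul_eq_mul,
        smul_eq_mul, mul_comm b (a′)]
      abel)
    (show (a * b) • z.2 = a • b • z.2 from mul_smul _ _ _)
  smul_zero a := Prod.ext
    (show a • (0 : V) - a′ • (0 : V) = 0 by simp)
    (show a • (0 : V) = 0 by simp)
  smul_add a y z := Prod.ext
    (show a • (y.1 + z.1) - a′ • (y.2 + z.2) = (a • y.1 - a′ • y.2) + (a • z.1 - a′ • z.2) by
      rw [smul_add, smul_add]; abel)
    (show a • (y.2 + z.2) = a • y.2 + a • z.2 from smul_add _ _ _)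
  add_smul a b z := Prod.ext
    (show (a + b) • z.1 - (a + b)′ • z.2 = (a • z.1 - a′ • z.2) + (b • z.1 - b′ • z.2) by
      rw [map_add, add_smul, add_smul]; abel)
    (show (a + b) • z.2 = a • z.2 + b • z.2 from add_smul _ _ _)
  zero_smul z := Prod.ext
    (show (0 : R) • z.1 - (0 : R)′ • z.2 = 0 by simp)
    (show (0 : R) • z.2 = 0 by simp)

variable {S : Type x} [CommRing S] [Differential S] {W : Type w} [AddCommGroup W] [Module S W]

/-- The prolongation functor on semilinear maps: `v₀ + ∂(v₁) ↦ f v₀ + ∂(f v₁)`. -/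
def map (φ : DiffHom R S) (f : V →ₛₗ[φ.toRingHom] W) :
    Prolong V →ₛₗ[φ.toRingHom] Prolong W where
  toFun z := (f z.1, f z.2)
  map_add' y z := Prod.ext (map_add f y.1 z.1) (map_add f y.2 z.2)
  map_smul' a z := Prod.ext
    (show f (a • z.1 - a′ • z.2) = φ.toRingHom a • f z.1 - (φ.toRingHom a)′ • f z.2 by
      rw [map_sub, map_smulₛₗ, map_smulₛₗ, φ.map_deriv'])
    (show f (a • z.2) = φ.toRingHom a • f z.2 from map_smulₛₗ f a z.2)

end Prolong

/-! ### Semilinear functoriality of exterior powers, symmetric powers and duals -/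

theorem symPow_update {V : Type w} {W : Type x} (n : ℕ) (f : V → W) [DecidableEq (ULift.{u} (Fin n))]
    (m : ULift.{u} (Fin n) → V) (i : ULift.{u} (Fin n)) (y : V) :
    (fun j : ULift.{v} (Fin n) => f (Function.update m i y ⟨j.down⟩))
      = Function.update (fun j : ULift.{v} (Fin n) => f (m ⟨j.down⟩)) ⟨i.down⟩ (f y) := by
  funext j
  rcases eq_or_ne j ⟨i.down⟩ with rfl | h
  · simp
  · rw [Function.update_of_ne h, Function.update_of_ne]
    rintro rfl
    exact h rfl

section Semilinear

variable {R : Type u} {S : Type v} [CommRing R] [CommRing S] (φ : R →+* S)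
  {V : Type w} {W : Type x} [AddCommGroup V] [AddCommGroup W] [Module R V] [Module S W]

/-- `f × g` for semilinear maps `f`, `g`. -/
def prodMapₛₗ {V' : Type w} {W' : Type x} [AddCommGroup V'] [AddCommGroup W'] [Module R V']
    [Module S W'] (f : V →ₛₗ[φ] W) (g : V' →ₛₗ[φ] W') : (V × V') →ₛₗ[φ] (W × W') where
  toFun z := (f z.1, g z.2)
  map_add' y z := Prod.ext (map_add f y.1 z.1) (map_add g y.2 z.2)
  map_smul' c z := Prod.ext (map_smulₛₗ f c z.1) (map_smulₛₗ g c z.2)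

/-- `⋀ⁿ f` for a semilinear map `f`: `v₁ ∧ ⋯ ∧ vₙ ↦ f v₁ ∧ ⋯ ∧ f vₙ`. -/
noncomputable def exteriorPowerMap (n : ℕ) (f : V →ₛₗ[φ] W) :
    (⋀[R]^n V) →ₛₗ[φ] (⋀[S]^n W) :=
  letI : Module R (⋀[S]^n W) := Module.compHom _ φ
  let a : V [⋀^Fin n]→ₗ[R] (⋀[S]^n W) :=
    { toFun := fun m => exteriorPower.ιMulti S n (f ∘ m)
      map_update_add' := fun {_} m i y z => by
        simp only [Function.comp_update, map_add]
        exact (exteriorPower.ιMulti S n).map_update_add' _ _ _ _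
      map_update_smul' := fun {_} m i c y => by
        simp only [Function.comp_update, map_smulₛₗ]
        exact (exteriorPower.ιMulti S n).map_update_smul' _ _ _ _
      map_eq_zero_of_eq' := fun m i j hm hij =>
        (exteriorPower.ιMulti S n).map_eq_zero_of_eq _ (congrArg f hm) hij }
  { toFun := exteriorPower.alternatingMapLinearEquiv a
    map_add' := map_add _
    map_smul' := fun c z => map_smul (exteriorPower.alternatingMapLinearEquiv a) c z }

theorem exteriorPowerMap_ιMulti (n : ℕ) (f : V →ₛₗ[φ] W) (m : Fin n → V) :
    exteriorPowerMap φ n f (exteriorPower.ιMulti R n m) = exteriorPower.ιMulti S n (f ∘ m) := by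
  let : Module R (⋀[S]^n W) := Module.compHom _ φ
  exact exteriorPower.alternatingMapLinearEquiv_apply_ιMulti _ m

/-- The `n`-th symmetric power. -/
abbrev SymPow (n : ℕ) (R : Type u) [CommRing R] (V : Type w) [AddCommGroup V] [Module R V] :
    Type (max u w) :=
  SymmetricPower R (ULift.{u} (Fin n)) V

/-- `Symⁿ f` for a semilinear map `f`: `v₁ ⋯ vₙ ↦ f v₁ ⋯ f vₙ`. -/
noncomputable def symPowMap (n : ℕ) (f : V →ₛₗ[φ] W) : SymPow n R V →ₛₗ[φ] SymPow n S W :=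
  letI : Module R (SymPow n S W) := Module.compHom _ φ
  let a : MultilinearMap R (fun _ : ULift.{u} (Fin n) => V) (SymPow n S W) :=
    { toFun := fun m => SymmetricPower.tprod S (fun i => f (m ⟨i.down⟩))
      map_update_add' := fun {_} m i y z => by
        simp only [symPow_update, map_add]
        exact (SymmetricPower.tprod S).map_update_add' _ _ _ _
      map_update_smul' := fun {_} m i c y => by
        simp only [symPow_update, map_smulₛₗ]
        exact (SymmetricPower.tprod S).map_update_smul' _ _ _ _ }
  let b : SymPow n R V →+ SymPow n S W :=
    AddCon.lift _ (PiTensorProduct.lift a).toAddMonoidHom (AddCon.addConGen_le.2 (by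
      rintro _ _ ⟨e, m⟩
      have h1 : ∀ t, PiTensorProduct.lift a (PiTensorProduct.tprod R t) = a t :=
        fun t => PiTensorProduct.lift.tprod t
      refine (h1 _).trans (Eq.trans ?_ (h1 _).symm)
      exact (SymmetricPower.tprod_equiv
        ((Equiv.ulift.trans Equiv.ulift.symm).trans (e.trans (Equiv.ulift.trans Equiv.ulift.symm)))
        (fun i : ULift.{v} (Fin n) => f (m ⟨i.down⟩))).symm))
  { toFun := b
    map_add' := map_add b
    map_smul' := fun c z => by
      induction z using AddCon.induction_on with
      | H z => exact map_smul (PiTensorProduct.lift a) c z }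

theorem symPowMap_tprod (n : ℕ) (f : V →ₛₗ[φ] W) (m : ULift.{u} (Fin n) → V) :
    symPowMap φ n f (SymmetricPower.tprod R m)
      = SymmetricPower.tprod S (fun i => f (m ⟨i.down⟩)) := by
  let : Module R (SymPow n S W) := Module.compHom _ φ
  exact (PiTensorProduct.lift.tprod (R := R) (s := fun _ : ULift.{u} (Fin n) => V)
    (E := SymPow n S W) (φ :=
      { toFun := fun m => SymmetricPower.tprod S (fun i => f (m ⟨i.down⟩))
        map_update_add' := fun {_} m i y z => by
          simp only [symPow_update, map_add]
          exact (SymmetricPower.tprod S).map_update_add' _ _ _ _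
        map_update_smul' := fun {_} m i c y => by
          simp only [symPow_update, map_smulₛₗ]
          exact (SymmetricPower.tprod S).map_update_smul' _ _ _ _ }) m)

open Classical in
/-- The contragredient of a semilinear map `f`: the semilinear map `D` between the dual modules with
`⟨D ℓ, f v⟩ = φ ⟨ℓ, v⟩`. It exists and is unique if `f` maps a finite basis to a basis, in
particular if `f` is bijective over an automorphism `φ` (then `D ℓ = φ ∘ ℓ ∘ f⁻¹`), or if `f` is the
canonical map `V → S ⊗ V` for a free module `V` of finite rank. -/
noncomputable def dualMap (f : V →ₛₗ[φ] W) : Module.Dual R V →ₛₗ[φ] Module.Dual S W :=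
  if h : ∃ D : Module.Dual R V →ₛₗ[φ] Module.Dual S W, ∀ ℓ v, D ℓ (f v) = φ (ℓ v)
  then h.choose else 0

theorem dualMap_apply (f : V →ₛₗ[φ] W)
    (h : ∃ D : Module.Dual R V →ₛₗ[φ] Module.Dual S W, ∀ ℓ v, D ℓ (f v) = φ (ℓ v))
    (ℓ : Module.Dual R V) (v : V) : dualMap φ f ℓ (f v) = φ (ℓ v) := by
  rw [dualMap, dif_pos h]
  exact h.choose_spec ℓ v

theorem exists_dualMap {ι : Type*} [Finite ι] (b : Module.Basis ι R V) (b' : Module.Basis ι S W)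
    (f : V →ₛₗ[φ] W) (h : ∀ i, f (b i) = b' i) :
    ∃ D : Module.Dual R V →ₛₗ[φ] Module.Dual S W, ∀ ℓ v, D ℓ (f v) = φ (ℓ v) := by
  refine ⟨{ toFun := fun ℓ => b'.constr ℤ (fun i => φ (ℓ (b i)))
            map_add' := fun ℓ m => b'.ext fun i => by simp
            map_smul' := fun c ℓ => b'.ext fun i => by simp }, fun ℓ v => ?_⟩
  induction b.mem_span v using Submodule.span_induction with
  | mem x hx => obtain ⟨i, rfl⟩ := hx; simp [h]
  | zero => simp
  | add x y _ _ hx hy => simp only [map_add, hx, hy]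
  | smul c x _ hx => simp only [map_smulₛₗ, smul_eq_mul, map_mul, hx, RingHom.id_apply]

section Linear

variable {V' : Type w} [AddCommGroup V'] [Module R V'] {V'' : Type w} [AddCommGroup V'']
  [Module R V'']

theorem exteriorPowerMap_id (n : ℕ) :
    exteriorPowerMap (RingHom.id R) n (LinearMap.id : V →ₗ[R] V) = LinearMap.id := by
  refine exteriorPower.linearMap_ext (AlternatingMap.ext fun m => ?_)
  exact exteriorPowerMap_ιMulti _ n _ m

theorem exteriorPowerMap_comp (n : ℕ) (g : V' →ₗ[R] V'') (h : V →ₗ[R] V') :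
    exteriorPowerMap (RingHom.id R) n (g ∘ₗ h)
      = exteriorPowerMap (RingHom.id R) n g ∘ₗ exteriorPowerMap (RingHom.id R) n h := by
  refine exteriorPower.linearMap_ext (AlternatingMap.ext fun m => ?_)
  refine (exteriorPowerMap_ιMulti _ n _ m).trans (Eq.symm ?_)
  exact (congrArg _ (exteriorPowerMap_ιMulti (RingHom.id R) n h m)).trans
    (exteriorPowerMap_ιMulti (RingHom.id R) n g _)

theorem symPowMap_id (n : ℕ) :
    symPowMap (RingHom.id R) n (LinearMap.id : V →ₗ[R] V) = LinearMap.id := by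
  refine LinearMap.ext_on (SymmetricPower.span_tprod_eq_top R _ V) ?_
  rintro _ ⟨m, rfl⟩
  exact symPowMap_tprod _ n _ m

theorem symPowMap_comp (n : ℕ) (g : V' →ₗ[R] V'') (h : V →ₗ[R] V') :
    symPowMap (RingHom.id R) n (g ∘ₗ h)
      = symPowMap (RingHom.id R) n g ∘ₗ symPowMap (RingHom.id R) n h := by
  refine LinearMap.ext_on (SymmetricPower.span_tprod_eq_top R _ V) ?_
  rintro _ ⟨m, rfl⟩
  refine (symPowMap_tprod _ n _ m).trans (Eq.symm ?_)
  exact (congrArg _ (symPowMap_tprod (RingHom.id R) n h m)).trans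
    (symPowMap_tprod (RingHom.id R) n g _)

/-- For an invertible linear map `g` the contragredient is `ℓ ↦ ℓ ∘ g⁻¹`. -/
theorem dualMap_eq (g : V →ₗ[R] V') (g' : V' →ₗ[R] V) (h₁ : g ∘ₗ g' = LinearMap.id)
    (h₂ : g' ∘ₗ g = LinearMap.id) : dualMap (RingHom.id R) g = Module.Dual.transpose g' := by
  refine LinearMap.ext fun ℓ => LinearMap.ext fun v => ?_
  have hv : v = g (g' v) := (LinearMap.congr_fun h₁ v).symm
  have hex : ∃ D : Module.Dual R V →ₗ[R] Module.Dual R V', ∀ ℓ v, D ℓ (g v) = ℓ v :=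
    ⟨Module.Dual.transpose g', fun ℓ v => congrArg ℓ (LinearMap.congr_fun h₂ v)⟩
  calc dualMap (RingHom.id R) g ℓ v = dualMap (RingHom.id R) g ℓ (g (g' v)) := by rw [← hv]
    _ = ℓ (g' v) := dualMap_apply (RingHom.id R) g hex ℓ (g' v)

theorem dualMap_id : dualMap (RingHom.id R) (LinearMap.id : V →ₗ[R] V) = LinearMap.id :=
  dualMap_eq _ LinearMap.id rfl rfl

theorem dualMap_comp (g g' h h' : V →ₗ[R] V) (hg : g ∘ₗ g' = LinearMap.id)
    (hg' : g' ∘ₗ g = LinearMap.id) (hh : h ∘ₗ h' = LinearMap.id) (hh' : h' ∘ₗ h = LinearMap.id) :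
    dualMap (RingHom.id R) (g ∘ₗ h) = dualMap (RingHom.id R) g ∘ₗ dualMap (RingHom.id R) h := by
  have e₁ : (g ∘ₗ h) ∘ₗ (h' ∘ₗ g') = LinearMap.id := LinearMap.ext fun z =>
    (congrArg g (LinearMap.congr_fun hh (g' z))).trans (LinearMap.congr_fun hg z)
  have e₂ : (h' ∘ₗ g') ∘ₗ (g ∘ₗ h) = LinearMap.id := LinearMap.ext fun z =>
    (congrArg h' (LinearMap.congr_fun hg' (h z))).trans (LinearMap.congr_fun hh' z)
  rw [dualMap_eq _ _ e₁ e₂, dualMap_eq _ _ hg hg', dualMap_eq _ _ hh hh']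
  rfl

end Linear

end Semilinear

/-! ### Constructions of differential linear algebra -/

/-- The constructions of differential linear algebra. -/
inductive Constr : Type
  | base : Constr
  | sum : Constr → Constr → Constr
  | tensor : Constr → Constr → Constr
  | sym : ℕ → Constr → Constr
  | ext : ℕ → Constr → Constr
  | dual : Constr → Constr
  | prolong : Constr → Constr

namespace Constr

/-- The module obtained from `V` by a construction of differential linear algebra. -/
noncomputable def obj (R : Type u) [CommRing R] [Differential R] (V : Type (max u w))
    [AddCommGroup V] [Module R V] : Constr → ModuleCat.{max u w} R
  | base => ModuleCat.of R V
  | sum a b => ModuleCat.of R (obj R V a × obj R V b)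
  | tensor a b => ModuleCat.of R (obj R V a ⊗[R] obj R V b)
  | sym n a => ModuleCat.of R (SymPow n R (obj R V a))
  | ext n a => ModuleCat.of R (⋀[R]^n (obj R V a))
  | dual a => ModuleCat.of R (Module.Dual R (obj R V a))
  | prolong a => ModuleCat.of R (Prolong (obj R V a))

variable {R : Type u} [CommRing R] [Differential R] {V : Type (max u w)}
    [AddCommGroup V] [Module R V] {S : Type v} [CommRing S] [Differential S] {W : Type (max v x)}
    [AddCommGroup W] [Module S W]

/-- Functoriality of the constructions: a semilinear map `f : V → W` over a morphism of differential
rings induces a semilinear map `c(V) → c(W)` for every construction `c`. This one operation gives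
the `q`-difference operator on `c(M)` (from `Sig`), the action of `g ∈ GL(V)` on `c(V)`, and the
comparison map `c(M) → c(R ⊗ M)` (from `M → R ⊗ M`). -/
noncomputable def map (φ : DiffHom R S) (f : V →ₛₗ[φ.toRingHom] W) :
    (c : Constr) → (obj.{u, w} R V c →ₛₗ[φ.toRingHom] obj.{v, x} S W c)
  | base => f
  | sum a b => prodMapₛₗ φ.toRingHom (map φ f a) (map φ f b)
  | tensor a b => TensorProduct.map (map φ f a) (map φ f b)
  | sym n a => symPowMap φ.toRingHom n (map φ f a)
  | ext n a => exteriorPowerMap φ.toRingHom n (map φ f a)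
  | dual a => dualMap φ.toRingHom (map φ f a)
  | prolong a => Prolong.map φ (map φ f a)


theorem map_id_mul (c : Constr) :
    map (V := V) (DiffHom.id R) LinearMap.id c = LinearMap.id ∧
    ∀ g h : V ≃ₗ[R] V, map (DiffHom.id R) ((g * h : V ≃ₗ[R] V) : V →ₗ[R] V) c
      = (map (DiffHom.id R) (g : V →ₗ[R] V) c) ∘ₗ (map (DiffHom.id R) (h : V →ₗ[R] V) c) := by
  induction c with
  | base => exact ⟨rfl, fun _ _ => rfl⟩
  | sum a b iha ihb =>
    exact ⟨congrArg₂ (prodMapₛₗ (RingHom.id R)) iha.1 ihb.1,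
      fun g h => congrArg₂ (prodMapₛₗ (RingHom.id R)) (iha.2 g h) (ihb.2 g h)⟩
  | tensor a b iha ihb =>
    exact ⟨(congrArg₂ TensorProduct.map iha.1 ihb.1).trans TensorProduct.map_id,
      fun g h => (congrArg₂ TensorProduct.map (iha.2 g h) (ihb.2 g h)).trans
        (TensorProduct.map_comp _ _ _ _)⟩
  | sym n a iha =>
    exact ⟨(congrArg (symPowMap (RingHom.id R) n) iha.1).trans (symPowMap_id n),
      fun g h => (congrArg (symPowMap (RingHom.id R) n) (iha.2 g h)).trans (symPowMap_comp n _ _)⟩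
  | ext n a iha =>
    exact ⟨(congrArg (exteriorPowerMap (RingHom.id R) n) iha.1).trans (exteriorPowerMap_id n),
      fun g h => (congrArg (exteriorPowerMap (RingHom.id R) n) (iha.2 g h)).trans
        (exteriorPowerMap_comp n _ _)⟩
  | dual a iha =>
    have hinv : ∀ g : V ≃ₗ[R] V, (map (DiffHom.id R) (g : V →ₗ[R] V) a) ∘ₗ
        (map (DiffHom.id R) ((g⁻¹ : V ≃ₗ[R] V) : V →ₗ[R] V) a) = LinearMap.id := fun g => by
      rw [← iha.2, mul_inv_cancel]
      exact iha.1
    exact ⟨(congrArg (dualMap (RingHom.id R)) iha.1).trans dualMap_id,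
      fun g h => (congrArg (dualMap (RingHom.id R)) (iha.2 g h)).trans
        (dualMap_comp _ _ _ _ (hinv g) (by simpa using hinv g⁻¹) (hinv h)
          (by simpa using hinv h⁻¹))⟩
  | prolong a iha =>
    exact ⟨congrArg (Prolong.map (DiffHom.id R)) iha.1,
      fun g h => congrArg (Prolong.map (DiffHom.id R)) (iha.2 g h)⟩

end Constr

/-! ### Extension of scalars -/

section BaseChange

variable {F : Type u} {L : Type v} {S : Type x} [CommRing F] [CommRing L] [CommRing S]

/-- `L ⊗_F M`, for a ring homomorphism `φ : F → L` and an `F`-module `M`. -/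
def BaseChange (φ : F →+* L) (M : Type w) [AddCommGroup M] [Module F M] : Type (max v w) :=
  letI := φ.toAlgebra
  L ⊗[F] M

namespace BaseChange

variable (φ : F →+* L) (M : Type w) [AddCommGroup M] [Module F M]

noncomputable instance : AddCommGroup (BaseChange φ M) :=
  letI := φ.toAlgebra
  (TensorProduct.addCommGroup : AddCommGroup (L ⊗[F] M))

noncomputable instance : Module L (BaseChange φ M) :=
  letI := φ.toAlgebra
  (TensorProduct.leftModule : Module L (L ⊗[F] M))

instance [Module.Finite F M] : Module.Finite L (BaseChange φ M) :=
  letI := φ.toAlgebra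
  (Module.Finite.base_change F L M : Module.Finite L (L ⊗[F] M))

/-- `l ⊗ m`. -/
noncomputable def tmul (l : L) (m : M) : BaseChange φ M :=
  letI := φ.toAlgebra
  (l ⊗ₜ[F] m : L ⊗[F] M)

/-- `m ↦ 1 ⊗ m`. -/
noncomputable def incl : M →ₛₗ[φ] BaseChange φ M where
  toFun m := tmul φ M 1 m
  map_add' m n :=
    letI := φ.toAlgebra
    TensorProduct.tmul_add (1 : L) m n
  map_smul' c m :=
    letI := φ.toAlgebra
    (TensorProduct.tmul_smul c (1 : L) m).trans (algebraMap_smul L c ((1 : L) ⊗ₜ[F] m)).symm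

variable {M}

/-- The semilinear map `l ⊗ m ↦ χ(l) j(m)` on `L ⊗_F M`, for a semilinear map `j` on `M`. -/
noncomputable def desc {W : Type*} [AddCommGroup W] [Module S W] (χ : L →+* S) {θ : F →+* S}
    (hθ : χ.comp φ = θ) (j : M →ₛₗ[θ] W) : BaseChange φ M →ₛₗ[χ] W :=
  letI := φ.toAlgebra
  let a : L →ₛₗ[θ] M →ₛₗ[θ] W :=
    { toFun := fun l => χ l • j
      map_add' := fun l l' => by rw [map_add, add_smul]
      map_smul' := fun c l => by
        rw [Algebra.smul_def, map_mul, mul_smul]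
        exact congrArg (· • χ l • j) (RingHom.congr_fun hθ c) }
  let b : L ⊗[F] M →ₛₗ[θ] W := TensorProduct.lift a
  { toFun := b
    map_add' := map_add b
    map_smul' := fun c z => TensorProduct.induction_on (motive := fun z => b (c • z) = χ c • b z) z
      (by rw [smul_zero, map_zero, smul_zero])
      (fun l m => show χ (c * l) • j m = χ c • χ l • j m by rw [map_mul, mul_smul])
      (fun y z hy hz => by rw [smul_add, map_add, map_add, smul_add, hy, hz]) }

theorem desc_incl {W : Type*} [AddCommGroup W] [Module S W] (χ : L →+* S) {θ : F →+* S}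
    (hθ : χ.comp φ = θ) (j : M →ₛₗ[θ] W) (m : M) : desc φ χ hθ j (incl φ M m) = j m :=
  show χ 1 • j m = j m by rw [map_one, one_smul]

theorem ext_incl {W : Type*} [AddCommGroup W] [Module S W] {χ : L →+* S}
    {f g : BaseChange φ M →ₛₗ[χ] W} (h : ∀ m, f (incl φ M m) = g (incl φ M m)) : f = g := by
  let := φ.toAlgebra
  refine LinearMap.ext fun z => TensorProduct.induction_on (motive := fun z => f z = g z) z
    ((map_zero f).trans (map_zero g).symm) (fun l m => ?_)
    (fun y z hy hz => (map_add f y z).trans ((congrArg₂ (· + ·) hy hz).trans (map_add g y z).symm))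
  have hl : (l ⊗ₜ[F] m : L ⊗[F] M) = l • (show L ⊗[F] M from incl φ M m) :=
    (congrArg (· ⊗ₜ[F] m) (mul_one l).symm)
  exact (congrArg f hl).trans ((map_smulₛₗ f l (incl φ M m)).trans ((congrArg (χ l • ·) (h m)).trans
    ((map_smulₛₗ g l (incl φ M m)).symm.trans (congrArg g hl).symm)))

end BaseChange

end BaseChange

/-! ### `q`-difference modules and the parameterized generic Galois group -/

/-- A `q`-difference module over a difference-differential field `F` with operator `σ`: a
finite-dimensional vector space with an invertible `σ`-semilinear operator. -/
structure QDiffModule (F : Type u) [Field F] [Differential F] (σ : DiffHom F F) where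
  carrier : Type (max u w)
  [addCommGroup : AddCommGroup carrier]
  [module : Module F carrier]
  [finite : Module.Finite F carrier]
  Sig : carrier →ₛₗ[σ.toRingHom] carrier
  bijective : Function.Bijective Sig

namespace QDiffModule

attribute [instance] addCommGroup module finite

variable {F : Type u} [Field F] [Differential F] {σ : DiffHom F F} (M : QDiffModule.{u, w} F σ)

/-- `N` is a sub-`q`-difference module of the construction `c(M)`. (The operator of `c(M)` is
bijective, so it is automatically bijective on a stable subspace `N`, by finite-dimensionality.) -/
def IsSub (c : Constr) (N : Submodule F (c.obj F M.carrier)) : Prop :=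
  ∀ n ∈ N, Constr.map σ M.Sig c n ∈ N

variable {R : Type v} [CommRing R] [Differential R]

/-- For a `∂`-`F`-algebra `φ : F → R` and a model `j : M → V` of `R ⊗_F M`, the submodule `N ⊗ R` of
`c(V) = c(M) ⊗ R` generated by a subspace `N` of the construction `c(M)`. -/
noncomputable def extend (φ : DiffHom F R) {V : Type (max v x)} [AddCommGroup V] [Module R V]
    (j : M.carrier →ₛₗ[φ.toRingHom] V) (c : Constr) (N : Submodule F (c.obj F M.carrier)) :
    Submodule R (c.obj R V) :=
  Submodule.span R (Constr.map φ j c '' N)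

/-- The group of `R`-points of the parameterized generic Galois group `Gal^∂(M)`, for a
`∂`-`F`-algebra `φ : F → R`, as a subgroup of `GL(V)`, where `j : M → V` is a model of `R ⊗_F M`
(i.e. `V` is an `R`-module and `j` is a `φ`-semilinear map inducing an isomorphism `R ⊗_F M ≅ V`):
the automorphisms stabilizing `N ⊗ R` for every sub-`q`-difference module `N` of every construction
of differential linear algebra of `M`. (For an invertible `g` the inclusion `g(N ⊗ R) ⊆ N ⊗ R`
already implies equality, because `N ⊗ R` is a direct summand of the free module `c(V)`.) -/
noncomputable def gal (φ : DiffHom F R) {V : Type (max v x)} [AddCommGroup V] [Module R V]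
    (j : M.carrier →ₛₗ[φ.toRingHom] V) : Subgroup (V ≃ₗ[R] V) where
  carrier := {g | ∀ (c : Constr) (N : Submodule F (c.obj F M.carrier)), M.IsSub c N →
    (M.extend φ j c N).map (Constr.map (DiffHom.id R) (g : V →ₗ[R] V) c) = M.extend φ j c N}
  one_mem' c N _ := by
    have h := (Constr.map_id_mul (V := V) (R := R) c).1
    exact (congrArg (fun f => (M.extend φ j c N).map f) h).trans (Submodule.map_id _)
  mul_mem' {g h} hg hh c N hN := by
    have e := (Constr.map_id_mul (V := V) (R := R) c).2 g h
    exact (congrArg (fun f => (M.extend φ j c N).map f) e).trans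
      ((Submodule.map_comp _ _ _).trans
        ((congrArg (Submodule.map _) (hh c N hN)).trans (hg c N hN)))
  inv_mem' {g} hg c N hN := by
    have e := (Constr.map_id_mul (V := V) (R := R) c).2 g⁻¹ g
    rw [inv_mul_cancel] at e
    have e' := e.symm.trans (Constr.map_id_mul (V := V) (R := R) c).1
    have h1 := (Submodule.map_comp (Constr.map (DiffHom.id R) (g : V →ₗ[R] V) c)
      (Constr.map (DiffHom.id R) ((g⁻¹ : V ≃ₗ[R] V) : V →ₗ[R] V) c) (M.extend φ j c N)).symm
    rw [hg c N hN] at h1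
    exact h1.trans ((congrArg (fun f => (M.extend φ j c N).map f) e').trans (Submodule.map_id _))

/-- `Gal^∂(M)(R)`, as a subgroup of `GL(R ⊗_F M)`, for a `∂`-`F`-algebra `φ : F → R`. -/
noncomputable def galPoints (φ : DiffHom F R) :
    Subgroup (BaseChange φ.toRingHom M.carrier ≃ₗ[R] BaseChange φ.toRingHom M.carrier) :=
  gal.{u, v, w, max u w} M φ (BaseChange.incl φ.toRingHom M.carrier)

/-- `(Gal^∂(M) ⊗_F L)(R)`, i.e. the group `Gal^∂(M)(R)` for a `∂`-`L`-algebra `ψ : L → R` regarded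
as a `∂`-`F`-algebra through `φ : F → L`. It is taken as a subgroup of
`GL(R ⊗_L N) = GL(R ⊗_F M)`, where `i : M → N` is a model `N` of `L ⊗_F M`. -/
noncomputable def galPointsOver {L : Type v} [Field L] [Differential L] {τ : DiffHom L L}
    (N : QDiffModule.{v, w} L τ) (φ : DiffHom F L) (i : M.carrier →ₛₗ[φ.toRingHom] N.carrier)
    {R : Type x} [CommRing R] [Differential R] (ψ : DiffHom L R) :
    Subgroup (BaseChange ψ.toRingHom N.carrier ≃ₗ[R] BaseChange ψ.toRingHom N.carrier) :=
  M.gal (ψ.comp φ) ((BaseChange.incl ψ.toRingHom N.carrier).comp i)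

/-- Extension of scalars `M ⊗_F L` along an extension `φ : F → L` of difference-differential fields,
with operator `l ⊗ m ↦ σ(l) ⊗ Sig(m)`. -/
noncomputable def baseChange {L : Type v} [Field L] [Differential L] {τ : DiffHom L L}
    (φ : DiffHom F L) (hσ : Function.Bijective σ.toRingHom) (hτ : Function.Bijective τ.toRingHom)
    (hφ : τ.comp φ = φ.comp σ) : QDiffModule.{v, max u w} L τ where
  carrier := BaseChange φ.toRingHom M.carrier
  Sig := BaseChange.desc φ.toRingHom τ.toRingHom (congrArg DiffHom.toRingHom hφ)
    ((BaseChange.incl φ.toRingHom M.carrier).comp M.Sig)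
  bijective := by
    let eσ := RingEquiv.ofBijective σ.toRingHom hσ
    let eτ := RingEquiv.ofBijective τ.toRingHom hτ
    have : RingHomInvPair σ.toRingHom eσ.symm.toRingHom := RingHomInvPair.of_ringEquiv eσ
    have : RingHomInvPair eσ.symm.toRingHom σ.toRingHom := RingHomInvPair.symm _ _
    have : RingHomInvPair τ.toRingHom eτ.symm.toRingHom := RingHomInvPair.of_ringEquiv eτ
    have : RingHomInvPair eτ.symm.toRingHom τ.toRingHom := RingHomInvPair.symm _ _
    let e := LinearEquiv.ofBijective M.Sig M.bijective
    have : RingHomCompTriple eσ.symm.toRingHom φ.toRingHom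
      (φ.toRingHom.comp eσ.symm.toRingHom) := ⟨rfl⟩
    have hinv : eτ.symm.toRingHom.comp φ.toRingHom = φ.toRingHom.comp eσ.symm.toRingHom := by
      refine RingHom.ext fun a => ?_
      have h := RingHom.congr_fun (congrArg DiffHom.toRingHom hφ) (eσ.symm a)
      refine (eτ.symm_apply_eq).2 (Eq.symm ?_)
      exact h.trans (congrArg φ.toRingHom (eσ.apply_symm_apply a))
    let f := BaseChange.desc φ.toRingHom τ.toRingHom (congrArg DiffHom.toRingHom hφ)
      ((BaseChange.incl φ.toRingHom M.carrier).comp M.Sig)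
    let g := BaseChange.desc φ.toRingHom eτ.symm.toRingHom hinv
      ((BaseChange.incl φ.toRingHom M.carrier).comp e.symm.toLinearMap)
    have hf : ∀ m, f (BaseChange.incl φ.toRingHom M.carrier m)
        = BaseChange.incl φ.toRingHom M.carrier (M.Sig m) := fun m => BaseChange.desc_incl _ _ _ _ m
    have hg : ∀ m, g (BaseChange.incl φ.toRingHom M.carrier m)
        = BaseChange.incl φ.toRingHom M.carrier (e.symm m) := fun m => BaseChange.desc_incl _ _ _ _ m
    have h1 : g.comp f = LinearMap.id := BaseChange.ext_incl _ fun m =>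
      (congrArg g (hf m)).trans ((hg _).trans (congrArg _ (e.symm_apply_apply m)))
    have h2 : f.comp g = LinearMap.id := BaseChange.ext_incl _ fun m =>
      (congrArg f (hg m)).trans ((hf _).trans (congrArg _ (e.apply_symm_apply m)))
    exact ⟨Function.LeftInverse.injective (g := g) fun z => LinearMap.congr_fun h1 z,
      Function.RightInverse.surjective (g := g) fun z => LinearMap.congr_fun h2 z⟩

end QDiffModule

/-! ### The fields `K(x)` -/

section RatFunc

open Polynomial

variable {K : Type u} {L : Type v} [Field K] [Field L]

/-- The formula for `x d/dx` on `K(x)`. -/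
noncomputable def ratFuncTheta (f : RatFunc K) : RatFunc K :=
  RatFunc.X * (algebraMap K[X] (RatFunc K) (derivative f.num * f.denom - f.num * derivative f.denom)
    / algebraMap K[X] (RatFunc K) (f.denom ^ 2))

theorem ratFuncTheta_div (p q : K[X]) (hq : q ≠ 0) :
    ratFuncTheta (algebraMap K[X] (RatFunc K) p / algebraMap K[X] (RatFunc K) q)
      = RatFunc.X * (algebraMap K[X] (RatFunc K) (derivative p * q - p * derivative q)
        / algebraMap K[X] (RatFunc K) (q ^ 2)) := by
  set f := algebraMap K[X] (RatFunc K) p / algebraMap K[X] (RatFunc K) q with hf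
  have hd : f.denom ≠ 0 := f.denom_ne_zero
  have h : f.num * q = p * f.denom := by
    apply RatFunc.algebraMap_injective K
    have h1 := f.num_div_denom
    rw [hf, div_eq_div_iff (RatFunc.algebraMap_ne_zero f.denom_ne_zero)
      (RatFunc.algebraMap_ne_zero hq), ← hf] at h1
    rw [map_mul, map_mul, h1]
  have h' := congrArg derivative h
  rw [derivative_mul, derivative_mul] at h'
  rw [ratFuncTheta]
  congr 1
  rw [div_eq_div_iff (RatFunc.algebraMap_ne_zero (pow_ne_zero 2 hd))
    (RatFunc.algebraMap_ne_zero (pow_ne_zero 2 hq)), ← map_mul, ← map_mul]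
  congr 1
  linear_combination f.denom * q * h' - (derivative f.denom * q + derivative q * f.denom) * h

theorem ratFuncTheta_add (f g : RatFunc K) :
    ratFuncTheta (f + g) = ratFuncTheta f + ratFuncTheta g := by
  induction f using RatFunc.induction_on with
  | f p q hq =>
  induction g using RatFunc.induction_on with
  | f r s hs =>
  have hq' := RatFunc.algebraMap_ne_zero hq
  have hs' := RatFunc.algebraMap_ne_zero hs
  rw [div_add_div _ _ hq' hs', ← map_mul, ← map_mul, ← map_mul, ← map_add,
    ratFuncTheta_div _ _ (mul_ne_zero hq hs), ratFuncTheta_div _ _ hq, ratFuncTheta_div _ _ hs]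
  simp only [map_sub, map_mul, map_add, map_pow, derivative_mul]
  field_simp
  ring

theorem ratFuncTheta_mul (f g : RatFunc K) :
    ratFuncTheta (f * g) = f * ratFuncTheta g + g * ratFuncTheta f := by
  induction f using RatFunc.induction_on with
  | f p q hq =>
  induction g using RatFunc.induction_on with
  | f r s hs =>
  have hq' := RatFunc.algebraMap_ne_zero hq
  have hs' := RatFunc.algebraMap_ne_zero hs
  rw [div_mul_div_comm, ← map_mul, ← map_mul,
    ratFuncTheta_div _ _ (mul_ne_zero hq hs), ratFuncTheta_div _ _ hq, ratFuncTheta_div _ _ hs]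
  simp only [map_sub, map_mul, map_add, map_pow, derivative_mul]
  field_simp
  ring

/-- `K(x)` as a differential field, with the derivation `x d/dx`. -/
noncomputable instance ratFuncDifferential : Differential (RatFunc K) :=
  Differential.ofFun ratFuncTheta ratFuncTheta_add ratFuncTheta_mul

/-- A homomorphism of rational function fields induced by a homomorphism of polynomial rings which
commutes with `x d/dx` is a morphism of differential fields. -/
theorem ratFuncTheta_mapRingHom (φ : K[X] →+* L[X]) (hφ : K[X]⁰ ≤ L[X]⁰.comap φ)
    (h : ∀ p, X * derivative (φ p) = φ (X * derivative p)) (f : RatFunc K) :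
    RatFunc.mapRingHom φ hφ (ratFuncTheta f) = ratFuncTheta (RatFunc.mapRingHom φ hφ f) := by
  have hdiv : ∀ p q : K[X], RatFunc.mapRingHom φ hφ
      (algebraMap K[X] (RatFunc K) p / algebraMap K[X] (RatFunc K) q)
      = algebraMap L[X] (RatFunc L) (φ p) / algebraMap L[X] (RatFunc L) (φ q) :=
    fun p q => RatFunc.map_apply_div φ hφ p q
  induction f using RatFunc.induction_on with
  | f p q hq =>
  have hq' : φ q ≠ 0 := mem_nonZeroDivisors_iff_ne_zero.1 (hφ (mem_nonZeroDivisors_iff_ne_zero.2 hq))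
  rw [hdiv, ratFuncTheta_div _ _ hq, ratFuncTheta_div _ _ hq', ← RatFunc.algebraMap_X,
    ← RatFunc.algebraMap_X, ← mul_div_assoc, ← mul_div_assoc, ← map_mul, ← map_mul, hdiv, map_pow]
  congr 2
  have e1 : X * (derivative p * q - p * derivative q)
      = (X * derivative p) * q - p * (X * derivative q) := by ring
  rw [e1, map_sub, map_mul _ (X * derivative p), map_mul _ p, ← h, ← h]
  ring

theorem algebraMap_comp_mapRingHom (φ : K[X] →+* L[X]) (hφ : K[X]⁰ ≤ L[X]⁰.comap φ) (p : K[X]) :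
    RatFunc.mapRingHom φ hφ (algebraMap K[X] (RatFunc K) p) = algebraMap L[X] (RatFunc L) (φ p) := by
  have h := RatFunc.map_apply_div φ hφ p 1
  rw [map_one, map_one, map_one, div_one, div_one] at h
  exact h

theorem ratFunc_ringHom_ext {S : Type*} [Field S] {φ ψ : RatFunc K →+* S}
    (h : ∀ p, φ (algebraMap K[X] (RatFunc K) p) = ψ (algebraMap K[X] (RatFunc K) p)) : φ = ψ := by
  refine RingHom.ext fun f => ?_
  induction f using RatFunc.induction_on with
  | f p q hq => rw [map_div₀, map_div₀, h, h]

/-- The morphism `K(x) → L(x)` extending a field homomorphism `K → L`. -/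
noncomputable def ratFuncMap (ι : K →+* L) : DiffHom (RatFunc K) (RatFunc L) where
  toRingHom := RatFunc.mapRingHom (Polynomial.mapRingHom ι)
    (nonZeroDivisors_le_comap_nonZeroDivisors_of_injective _ (Polynomial.map_injective ι ι.injective))
  map_deriv' f := ratFuncTheta_mapRingHom (Polynomial.mapRingHom ι) _
    (fun p => by simp [derivative_map]) f

theorem compRingHom_unit_injective (q : Kˣ) :
    Function.Injective (Polynomial.compRingHom (C (q : K) * X)) := by
  refine Function.LeftInverse.injective (g := Polynomial.compRingHom (C (↑q⁻¹ : K) * X)) fun p => ?_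
  simp [comp_assoc, ← mul_assoc, ← C_mul]

/-- The `q`-difference operator `f(x) ↦ f(qx)` on `K(x)`. -/
noncomputable def qShift (q : Kˣ) : DiffHom (RatFunc K) (RatFunc K) where
  toRingHom := RatFunc.mapRingHom (Polynomial.compRingHom (C (q : K) * X))
    (nonZeroDivisors_le_comap_nonZeroDivisors_of_injective _ (compRingHom_unit_injective q))
  map_deriv' f := ratFuncTheta_mapRingHom (Polynomial.compRingHom (C (q : K) * X)) _
    (fun p => by simp [derivative_comp]; ring) f

theorem qShift_bijective (q : Kˣ) : Function.Bijective (qShift q).toRingHom := by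
  have h : ∀ r : Kˣ, (qShift r).toRingHom.comp (qShift r⁻¹).toRingHom = RingHom.id _ := fun r =>
    ratFunc_ringHom_ext fun p => by
      simp only [RingHom.comp_apply, qShift, algebraMap_comp_mapRingHom, RingHom.id_apply]
      simp [comp_assoc, ← mul_assoc, ← C_mul]
  refine ⟨(qShift q).toRingHom.injective, fun f => ⟨(qShift q⁻¹).toRingHom f, ?_⟩⟩
  exact RingHom.congr_fun (h q) f

theorem qShift_comp_ratFuncMap (ι : K →+* L) (q : Kˣ) :
    (qShift (Units.map (ι : K →* L) q)).comp (ratFuncMap ι) = (ratFuncMap ι).comp (qShift q) := by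
  have h : ((qShift (Units.map (ι : K →* L) q)).comp (ratFuncMap ι)).toRingHom
      = ((ratFuncMap ι).comp (qShift q)).toRingHom := ratFunc_ringHom_ext fun p => by
    simp only [RingHom.comp_apply, DiffHom.comp, qShift, ratFuncMap, algebraMap_comp_mapRingHom]
    simp [Polynomial.map_comp]
  revert h
  generalize (qShift (Units.map (ι : K →* L) q)).comp (ratFuncMap ι) = a
  generalize (ratFuncMap ι).comp (qShift q) = b
  cases a; cases b
  rintro rfl
  rfl

theorem ratFuncMap_comp {E : Type w} [Field E] (ι : K →+* L) (κ : L →+* E) :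
    (ratFuncMap κ).toRingHom.comp (ratFuncMap ι).toRingHom = (ratFuncMap (κ.comp ι)).toRingHom :=
  ratFunc_ringHom_ext fun p => by
    simp only [RingHom.comp_apply, ratFuncMap, algebraMap_comp_mapRingHom]
    simp [Polynomial.map_map]

end RatFunc

/-! ### Extending the field of constants -/

namespace QDiffModule

variable {K : Type u} {L : Type v} [Field K] [Field L] {q : Kˣ}
  (M : QDiffModule.{u, w} (RatFunc K) (qShift q))

/-- The `q`-difference module `M ⊗_{K(x)} L(x)`, for a field extension `ι : K → L`. -/
noncomputable def overField (ι : K →+* L) :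
    QDiffModule.{v, max u w} (RatFunc L) (qShift (Units.map (ι : K →* L) q)) :=
  M.baseChange (ratFuncMap ι) (qShift_bijective q) (qShift_bijective _)
    (qShift_comp_ratFuncMap ι q)

/-- The canonical map `M → M ⊗_{K(x)} L(x)`. -/
noncomputable def toOverField (ι : K →+* L) :
    M.carrier →ₛₗ[(ratFuncMap ι).toRingHom] (M.overField ι).carrier :=
  BaseChange.incl (ratFuncMap ι).toRingHom M.carrier

/-- The canonical map `M ⊗_{K(x)} K'(x) → M ⊗_{K(x)} L(x)`, `f ⊗ m ↦ f ⊗ m`, for extensions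
`K → K' → L`. -/
noncomputable def overFieldMap {K' : Type x} [Field K'] (ι : K →+* L) (ι' : K →+* K')
    (κ : K' →+* L) (h : κ.comp ι' = ι) :
    (M.overField ι').carrier →ₛₗ[(ratFuncMap κ).toRingHom] (M.overField ι).carrier :=
  BaseChange.desc (ratFuncMap ι').toRingHom (ratFuncMap κ).toRingHom
    ((ratFuncMap_comp ι' κ).trans (congrArg (fun t => (ratFuncMap t).toRingHom) h))
    (M.toOverField ι)

end QDiffModule

-- Let `L/K` be an extension of constants, `N = L(x) ⊗ M`. A construction `c` commutes with
-- extension of scalars: a map carrying a basis to a basis (`MatchesBasis`) still does so after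
-- applying `c` (`Constr.matchesBasis_map`), so `c(N) = L(x) ⊗ c(M)`. Hence a sub-`q`-difference
-- module of `c(M)` generates one of `c(N)`, both generate the same `R`-submodule, and whatever
-- stabilizes all submodules for `N` stabilizes those for `M` (`gal_le_gal`).
--
-- The converse holds because every `a ∈ L` satisfies `σ_q(a) = a`. Take a sub-`q`-difference module
-- `P` of `c(N)` and `n ∈ P`. After multiplication by a nonzero `d ∈ L[x]`, `n` becomes a sum `∑ aᵢ
-- tᵢ` with `aᵢ ∈ L` and `tᵢ` in the image of `c(M)`. The map `(vᵢ) ↦ ∑ aᵢ vᵢ` from a direct sum of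
-- copies of `c(M)` to `c(N)` commutes with the `q`-difference operators because the `aᵢ` are
-- constants, and it extends `GL`-equivariantly over `R`. The preimage of `P` is therefore a
-- sub-`q`-difference module of a construction of `M`; a `g` in the group of `M` preserves it, so
-- `g(dn) ∈ P ⊗ R`, and dividing by `d` gives `g(n) ∈ P ⊗ R` (`IsReached`, `exists_isReached_smul`,
-- `gal_eq_gal`). No descent of `P` to a smaller field is needed, so the two groups agree already
-- for `K' = K`.

universe y

/-! ### Semilinear maps carrying a finite basis to a basis -/

section MatchesBasis

variable {R : Type u} {S : Type v} [CommRing R] [CommRing S] (φ : R →+* S)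
  {V : Type w} {W : Type x} [AddCommGroup V] [AddCommGroup W] [Module R V] [Module S W]

/-- The semilinear map `f : V → W` carries a finite basis of `V` to a basis of `W`. Equivalently,
`V` is free of finite rank and `f` exhibits `W` as `S ⊗ V`. -/
def MatchesBasis (f : V →ₛₗ[φ] W) : Prop :=
  ∃ (n : ℕ) (b : Module.Basis (Fin n) R V) (b' : Module.Basis (Fin n) S W), ∀ i, f (b i) = b' i

variable {φ}

theorem MatchesBasis.of_basis {ι : Type*} [Finite ι] {f : V →ₛₗ[φ] W} (b : Module.Basis ι R V)
    (b' : Module.Basis ι S W) (h : ∀ i, f (b i) = b' i) : MatchesBasis φ f := by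
  obtain ⟨n, ⟨e⟩⟩ := Finite.exists_equiv_fin ι
  exact ⟨n, b.reindex e, b'.reindex e, fun i => by simp [h]⟩

theorem MatchesBasis.span_range {f : V →ₛₗ[φ] W} (h : MatchesBasis φ f) :
    Submodule.span S (Set.range f) = ⊤ := by
  obtain ⟨n, b, b', h⟩ := h
  rw [eq_top_iff, ← b'.span_eq]
  refine Submodule.span_mono ?_
  rintro _ ⟨i, rfl⟩
  exact ⟨b i, h i⟩

/-- Guarantees that `dualMap`, which is defined by choice with default value `0`, is the true
contragredient. -/
theorem MatchesBasis.exists_dualMap {f : V →ₛₗ[φ] W} (h : MatchesBasis φ f) :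
    ∃ D : Module.Dual R V →ₛₗ[φ] Module.Dual S W, ∀ ℓ v, D ℓ (f v) = φ (ℓ v) := by
  obtain ⟨n, b, b', h⟩ := h
  exact _root_.exists_dualMap φ b b' f h

/-- Over a field, it suffices that the image of `f` generates `W` and that linear forms extend
along `f`. -/
theorem MatchesBasis.of_extend {F : Type u} [Field F] {φ : F →+* S} [Module F V]
    [Module.Finite F V] {f : V →ₛₗ[φ] W} (hspan : Submodule.span S (Set.range f) = ⊤)
    (hext : ∀ ℓ : V →ₗ[F] F, ∃ ℓ' : W →ₗ[S] S, ∀ v, ℓ' (f v) = φ (ℓ v)) : MatchesBasis φ f := by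
  let b := Module.finBasis F V
  have hli : LinearIndependent S (fun i => f (b i)) := by
    rw [Fintype.linearIndependent_iff]
    intro g hg i
    -- A form extending the `i`-th coordinate form, applied to a linear relation, isolates its
    -- `i`-th coefficient.
    obtain ⟨ℓ', h⟩ := hext (b.coord i)
    have := congrArg ℓ' hg
    simpa [h, Finsupp.single_apply, apply_ite φ] using this
  have hsp : ⊤ ≤ Submodule.span S (Set.range fun i => f (b i)) := by
    rw [← hspan, Submodule.span_le]
    rintro _ ⟨v, rfl⟩
    rw [← b.sum_repr v, map_sum]
    refine Submodule.sum_mem _ fun i _ => ?_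
    rw [map_smulₛₗ]
    exact Submodule.smul_mem _ _ (Submodule.subset_span ⟨i, rfl⟩)
  exact ⟨_, b, Module.Basis.mk hli hsp, fun i => by simp⟩

theorem MatchesBasis.prodMapₛₗ {V' : Type w} {W' : Type x} [AddCommGroup V'] [AddCommGroup W']
    [Module R V'] [Module S W'] {f : V →ₛₗ[φ] W} {g : V' →ₛₗ[φ] W'} (hf : MatchesBasis φ f)
    (hg : MatchesBasis φ g) : MatchesBasis φ (prodMapₛₗ φ f g) := by
  obtain ⟨m, b, b', h⟩ := hf
  obtain ⟨n, c, c', h'⟩ := hg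
  refine .of_basis (b.prod c) (b'.prod c') ?_
  rintro (i | i)
  · exact Prod.ext (by simp [_root_.prodMapₛₗ, h]) (by simp [_root_.prodMapₛₗ])
  · exact Prod.ext (by simp [_root_.prodMapₛₗ]) (by simp [_root_.prodMapₛₗ, h'])

theorem MatchesBasis.tensorMap {V' : Type w} {W' : Type x} [AddCommGroup V'] [AddCommGroup W']
    [Module R V'] [Module S W'] {f : V →ₛₗ[φ] W} {g : V' →ₛₗ[φ] W'} (hf : MatchesBasis φ f)
    (hg : MatchesBasis φ g) : MatchesBasis φ (TensorProduct.map f g) := by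
  obtain ⟨m, b, b', h⟩ := hf
  obtain ⟨n, c, c', h'⟩ := hg
  refine .of_basis (b.tensorProduct c) (b'.tensorProduct c') fun i => ?_
  simp [Module.Basis.tensorProduct_apply', h, h']

theorem MatchesBasis.exteriorPowerMap (n : ℕ) {f : V →ₛₗ[φ] W} (hf : MatchesBasis φ f) :
    MatchesBasis φ (exteriorPowerMap φ n f) := by
  obtain ⟨m, b, b', h⟩ := hf
  refine .of_basis (b.exteriorPower n) (b'.exteriorPower n) fun s => ?_
  rw [exteriorPower.basis_apply, exteriorPower.basis_apply]
  simp only [exteriorPower.ιMulti_family, exteriorPowerMap_ιMulti]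
  congr 1
  funext i
  exact h _

theorem MatchesBasis.dualMap {f : V →ₛₗ[φ] W} (hf : MatchesBasis φ f) :
    MatchesBasis φ (dualMap φ f) := by
  have hex := hf.exists_dualMap
  obtain ⟨m, b, b', h⟩ := hf
  refine .of_basis b.dualBasis b'.dualBasis fun i => b'.ext fun k => ?_
  rw [← h, dualMap_apply φ f hex, h]
  simp [Finsupp.single_apply, apply_ite φ]

/-- The symmetric power is a quotient of the tensor power, whose basis tensors therefore still
generate it. The family repeats monomials under permutation of indices, so it is not a basis in
general. -/
theorem SymmetricPower.span_tprod_basis {ι : Type*} {T : Type u} [Finite T] (b : Module.Basis ι R V) :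
    Submodule.span R (Set.range fun p : T → ι => SymmetricPower.tprod R (b ∘ p)) = ⊤ := by
  rw [← SymmetricPower.range_mk R T V, LinearMap.range_eq_map,
    ← (Basis.piTensorProduct fun _ : T => b).span_eq, Submodule.map_span, ← Set.range_comp]
  congr 2
  funext p
  exact (congrArg (SymmetricPower.mk R T V) (Basis.piTensorProduct_apply _ p)).symm

/-- Prescribing a linear form on a symmetric power by its symmetric values on a basis. -/
theorem SymmetricPower.exists_dual {ι : Type*} {T : Type u} [Finite T] (b : Module.Basis ι R V)
    (a : (T → ι) → R) (ha : ∀ (e : Equiv.Perm T) p, a (p ∘ e) = a p) :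
    ∃ ℓ : SymmetricPower R T V →ₗ[R] R, ∀ p, ℓ (SymmetricPower.tprod R (b ∘ p)) = a p := by
  let H : (⨂[R] _ : T, V) →ₗ[R] R := (Basis.piTensorProduct fun _ : T => b).constr R a
  have hH : ∀ p : T → ι, H (PiTensorProduct.tprod R (b ∘ p)) = a p := fun p => by
    have := (Basis.piTensorProduct fun _ : T => b).constr_basis R a p
    rwa [Basis.piTensorProduct_apply] at this
  -- Multilinearity propagates the symmetry from basis vectors to all arguments, so `H` descends to
  -- the quotient by permutations.
  have hsymm : ∀ e : Equiv.Perm T, (H.compMultilinearMap (PiTensorProduct.tprod R)).domDomCongr e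
      = H.compMultilinearMap (PiTensorProduct.tprod R) := fun e =>
    Module.Basis.ext_multilinear (fun _ => b) fun p => ((hH (p ∘ e)).trans (ha e p)).trans
      (hH p).symm
  let ℓ : SymmetricPower R T V →+ R := AddCon.lift _ H.toAddMonoidHom (AddCon.addConGen_le.2 (by
    rintro _ _ ⟨e, m⟩
    exact (congrArg (fun t => t m) (hsymm e)).symm))
  refine ⟨{ toFun := ℓ
            map_add' := map_add ℓ
            map_smul' := fun c z => ?_ }, hH⟩
  induction z using AddCon.induction_on with
  | H z => exact map_smul H c z

/-- No basis of monomials is written down. Over a field, `MatchesBasis.of_extend` only asks that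
linear forms extend, and a form on `Symⁿ V` is transported through its symmetric values on products
of basis vectors. -/
theorem MatchesBasis.symPowMap {F : Type u} [Field F] {φ : F →+* S} [Module F V] (n : ℕ)
    {f : V →ₛₗ[φ] W} (hf : MatchesBasis φ f) : MatchesBasis φ (symPowMap φ n f) := by
  obtain ⟨m, b, b', h⟩ := hf
  have hval : ∀ p : ULift.{u} (Fin n) → Fin m,
      _root_.symPowMap φ n f (SymmetricPower.tprod F (b ∘ p))
        = SymmetricPower.tprod S (b' ∘ fun i : ULift.{v} (Fin n) => p ⟨i.down⟩) := fun p => by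
    rw [symPowMap_tprod]
    congr 1
    funext i
    exact h _
  have : Module.Finite F (SymPow n F V) := Module.finite_def.2 (by
    rw [← SymmetricPower.span_tprod_basis b]
    exact Submodule.fg_span (Set.finite_range _))
  refine .of_extend ?_ fun ℓ => ?_
  · rw [eq_top_iff, ← SymmetricPower.span_tprod_basis b']
    refine Submodule.span_mono ?_
    rintro _ ⟨p, rfl⟩
    exact ⟨_, hval fun i => p ⟨i.down⟩⟩
  · obtain ⟨ℓ', h'⟩ := SymmetricPower.exists_dual (T := ULift.{v} (Fin n)) b'
      (fun p => φ (ℓ (SymmetricPower.tprod F (b ∘ fun i : ULift.{u} (Fin n) => p ⟨i.down⟩))))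
      (fun e p => congrArg (fun t => φ (ℓ t)) (SymmetricPower.tprod_equiv
        ((Equiv.ulift.trans Equiv.ulift.symm).trans (e.trans (Equiv.ulift.trans Equiv.ulift.symm)))
        (b ∘ fun i : ULift.{u} (Fin n) => p ⟨i.down⟩)))
    refine ⟨ℓ', fun z => ?_⟩
    have hz : z ∈ Submodule.span F (Set.range fun p : ULift.{u} (Fin n) → Fin m =>
        SymmetricPower.tprod F (b ∘ p)) := by
      rw [SymmetricPower.span_tprod_basis]; trivial
    induction hz using Submodule.span_induction with
    | mem z hz =>
      obtain ⟨p, rfl⟩ := hz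
      exact (congrArg ℓ' (hval p)).trans (h' _)
    | zero => simp
    | add y z _ _ hy hz => simp only [map_add, hy, hz]
    | smul c z _ hz => simp only [map_smulₛₗ, smul_eq_mul, map_mul, hz, RingHom.id_apply]

end MatchesBasis

/-! ### Bases of prolongations -/

section Prolong

variable {R : Type u} [CommRing R] [Differential R] {V : Type w} [AddCommGroup V] [Module R V]

/-- The basis of `F_∂(V)` consisting of the `bᵢ` and the `∂(bᵢ)`. -/
noncomputable def Prolong.basis {n : ℕ} (b : Module.Basis (Fin n) R V) :
    Module.Basis (Fin n ⊕ Fin n) R (Prolong V) :=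
  have smul_def : ∀ (a : R) (z : Prolong V), a • z = ((a • z.1 - a′ • z.2, a • z.2) : V × V) :=
    fun _ _ => rfl
  .ofEquivFun
    -- The Leibniz rule `∂(c b) = c ∂(b) + c′ b` makes the coefficient `c` of `bᵢ` in the second
    -- component contribute `c′` to the coordinate at `bᵢ`.
    { toFun := fun z => Sum.elim (fun i => b.repr z.1 i + (b.repr z.2 i)′) (fun i => b.repr z.2 i)
      invFun := fun t => ((∑ i, (t (.inl i) - (t (.inr i))′) • b i, ∑ i, t (.inr i) • b i) : V × V)
      map_add' := fun y z => by
        have h1 : (y + z).1 = y.1 + z.1 := rfl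
        have h2 : (y + z).2 = y.2 + z.2 := rfl
        funext i
        rcases i with i | i
        · simp [h1, h2]; ring
        · simp [h2]
      map_smul' := fun a z => by
        funext i
        rcases i with i | i
        · simp [smul_def, Derivation.leibniz]; ring
        · simp [smul_def]
      left_inv := fun z => Prod.ext (by simp [b.sum_repr]) (by simp [b.sum_repr])
      right_inv := fun t => by
        funext i
        rcases i with i | i
        · exact (congrArg₂ (fun c d => c + d′) (congrFun (b.repr_sum_self _) i)
            (congrFun (b.repr_sum_self _) i)).trans (sub_add_cancel _ _)
        · exact congrFun (b.repr_sum_self _) i }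

theorem Prolong.basis_apply {n : ℕ} (b : Module.Basis (Fin n) R V) (k : Fin n ⊕ Fin n) :
    Prolong.basis b k = ((∑ i, ((Pi.single k 1 : Fin n ⊕ Fin n → R) (.inl i)
        - ((Pi.single k 1 : Fin n ⊕ Fin n → R) (.inr i))′) • b i,
      ∑ i, (Pi.single k 1 : Fin n ⊕ Fin n → R) (.inr i) • b i) : V × V) := by
  rw [Prolong.basis, Module.Basis.coe_ofEquivFun]
  rfl

theorem Prolong.basis_inl {n : ℕ} (b : Module.Basis (Fin n) R V) (i : Fin n) :
    Prolong.basis b (.inl i) = ((b i, 0) : V × V) := by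
  rw [Prolong.basis_apply]
  exact Prod.ext (by simp [Pi.single_apply]) (by simp)

theorem Prolong.basis_inr {n : ℕ} (b : Module.Basis (Fin n) R V) (i : Fin n) :
    Prolong.basis b (.inr i) = ((0, b i) : V × V) := by
  rw [Prolong.basis_apply]
  have : ∀ k, ((Pi.single (Sum.inr i) 1 : Fin n ⊕ Fin n → R) (Sum.inr k))′ = 0 := fun k => by
    rcases eq_or_ne k i with rfl | h
    · simp
    · simp [h]
  exact Prod.ext (by simp [this]) (by simp [Pi.single_apply])

theorem MatchesBasis.prolongMap {S : Type v} [CommRing S] [Differential S] {W : Type x}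
    [AddCommGroup W] [Module S W] {φ : DiffHom R S} {f : V →ₛₗ[φ.toRingHom] W}
    (hf : MatchesBasis φ.toRingHom f) : MatchesBasis φ.toRingHom (Prolong.map φ f) := by
  obtain ⟨m, b, b', h⟩ := hf
  refine .of_basis (Prolong.basis b) (Prolong.basis b') ?_
  rintro (i | i)
  · rw [Prolong.basis_inl, Prolong.basis_inl]
    exact Prod.ext (h i) (map_zero f)
  · rw [Prolong.basis_inr, Prolong.basis_inr]
    exact Prod.ext (map_zero f) (h i)

end Prolong

/-! ### Functoriality of the constructions -/

section Comp

variable {R : Type*} {S : Type*} {T : Type*} [CommRing R] [CommRing S] [CommRing T]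
  {φ : R →+* S} {χ : S →+* T} {θ : R →+* T} [RingHomCompTriple φ χ θ]
  {V : Type*} {W : Type*} {U : Type*} [AddCommGroup V] [AddCommGroup W] [AddCommGroup U]
  [Module R V] [Module S W] [Module T U]

theorem exteriorPowerMap_comp_apply (n : ℕ) (g : W →ₛₗ[χ] U) (f : V →ₛₗ[φ] W) (z : ⋀[R]^n V) :
    exteriorPowerMap θ n (g.comp f) z = exteriorPowerMap χ n g (exteriorPowerMap φ n f z) := by
  have hz : z ∈ Submodule.span R (Set.range (exteriorPower.ιMulti R n (M := V))) := by
    rw [exteriorPower.ιMulti_span]; trivial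
  induction hz using Submodule.span_induction with
  | mem z hz =>
    obtain ⟨m, rfl⟩ := hz
    simp only [exteriorPowerMap_ιMulti]
    rfl
  | zero => simp
  | add y z _ _ hy hz => simp only [map_add, hy, hz]
  | smul c z _ hz =>
    simp only [map_smulₛₗ, hz, ← RingHomCompTriple.comp_apply (σ₁₂ := φ) (σ₂₃ := χ) (σ₁₃ := θ)]

theorem symPowMap_comp_apply (n : ℕ) (g : W →ₛₗ[χ] U) (f : V →ₛₗ[φ] W) (z : SymPow n R V) :
    symPowMap θ n (g.comp f) z = symPowMap χ n g (symPowMap φ n f z) := by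
  have hz : z ∈ Submodule.span R (Set.range (SymmetricPower.tprod R (M := V))) := by
    rw [SymmetricPower.span_tprod_eq_top]; trivial
  induction hz using Submodule.span_induction with
  | mem z hz =>
    obtain ⟨m, rfl⟩ := hz
    simp only [symPowMap_tprod]
    rfl
  | zero => simp
  | add y z _ _ hy hz => simp only [map_add, hy, hz]
  | smul c z _ hz =>
    simp only [map_smulₛₗ, hz, ← RingHomCompTriple.comp_apply (σ₁₂ := φ) (σ₂₃ := χ) (σ₁₃ := θ)]

theorem tensorMap_comp_apply {V' W' U' : Type*} [AddCommGroup V'] [AddCommGroup W']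
    [AddCommGroup U'] [Module R V'] [Module S W'] [Module T U'] (g : W →ₛₗ[χ] U) (f : V →ₛₗ[φ] W)
    (g' : W' →ₛₗ[χ] U') (f' : V' →ₛₗ[φ] W') (z : V ⊗[R] V') :
    TensorProduct.map (σ₁₂ := θ) (g.comp f) (g'.comp f') z
      = TensorProduct.map g g' (TensorProduct.map f f' z) := by
  induction z using TensorProduct.induction_on with
  | zero => simp
  | tmul y z => rfl
  | add y z hy hz => simp only [map_add, hy, hz]

/-- Both sides send `g (f v)` to `θ (ℓ v)`, and these vectors generate `U`. The basis hypotheses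
ensure that all three contragredients exist. -/
theorem MatchesBasis.dualMap_comp_apply {g : W →ₛₗ[χ] U} {f : V →ₛₗ[φ] W} (hg : MatchesBasis χ g)
    (hf : MatchesBasis φ f) (ℓ : Module.Dual R V) :
    _root_.dualMap θ (g.comp f) ℓ = _root_.dualMap χ g (_root_.dualMap φ f ℓ) := by
  have hval : ∀ v, _root_.dualMap χ g (_root_.dualMap φ f ℓ) (g (f v)) = θ (ℓ v) := fun v => by
    rw [dualMap_apply χ g hg.exists_dualMap, dualMap_apply φ f hf.exists_dualMap,
      RingHomCompTriple.comp_apply]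
  have hex : ∃ D : Module.Dual R V →ₛₗ[θ] Module.Dual T U, ∀ ℓ v, D ℓ ((g.comp f) v) = θ (ℓ v) := by
    obtain ⟨D, hD⟩ := hf.exists_dualMap
    obtain ⟨E, hE⟩ := hg.exists_dualMap
    exact ⟨E.comp D, fun ℓ v => by simp [hE, hD, RingHomCompTriple.comp_apply]⟩
  have hspan : ∀ y, ∀ ℓ₁ ℓ₂ : Module.Dual T U, (∀ v, ℓ₁ (g (f v)) = ℓ₂ (g (f v))) →
      ℓ₁ (g y) = ℓ₂ (g y) := fun y ℓ₁ ℓ₂ h => by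
    have hy : y ∈ Submodule.span S (Set.range f) := by rw [hf.span_range]; trivial
    induction hy using Submodule.span_induction with
    | mem y hy => obtain ⟨v, rfl⟩ := hy; exact h v
    | zero => simp
    | add y z _ _ hy hz => simp only [map_add, hy, hz]
    | smul c z _ hz => simp only [map_smulₛₗ, hz]
  refine LinearMap.ext_on hg.span_range ?_
  rintro _ ⟨y, rfl⟩
  exact hspan y _ _ fun v => (dualMap_apply θ (g.comp f) hex ℓ v).trans (hval v).symm

end Comp

namespace Constr

/-- Constructions commute with extension of scalars. The source ring is a field for the sake of
symmetric powers; the target may be any differential ring, as needed for `R`-points. -/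
theorem matchesBasis_map {F : Type u} [Field F] [Differential F] {S : Type v} [CommRing S]
    [Differential S] {V : Type (max u w)} [AddCommGroup V] [Module F V] {W : Type (max v x)}
    [AddCommGroup W] [Module S W] (φ : DiffHom F S) {f : V →ₛₗ[φ.toRingHom] W}
    (hf : MatchesBasis φ.toRingHom f) (c : Constr) :
    MatchesBasis φ.toRingHom (map.{u, v, w, x} φ f c) := by
  induction c with
  | base => exact hf
  | sum a b iha ihb => exact MatchesBasis.prodMapₛₗ iha ihb
  | tensor a b iha ihb => exact MatchesBasis.tensorMap iha ihb
  | sym n a iha => exact MatchesBasis.symPowMap n iha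
  | ext n a iha => exact MatchesBasis.exteriorPowerMap n iha
  | dual a iha => exact MatchesBasis.dualMap iha
  | prolong a iha => exact MatchesBasis.prolongMap iha

universe z

/-- The basis hypotheses serve the dual case, the only one where functoriality can fail. The middle
ring is a field so that `matchesBasis_map` applies to `g`. -/
theorem map_comp_apply {F : Type u} [Field F] [Differential F] {L : Type v} [Field L]
    [Differential L] {T : Type y} [CommRing T] [Differential T] {V : Type (max u w)}
    [AddCommGroup V] [Module F V] {W : Type (max v x)} [AddCommGroup W] [Module L W]
    {U : Type (max y z)} [AddCommGroup U] [Module T U] (φ : DiffHom F L) (χ : DiffHom L T)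
    {f : V →ₛₗ[φ.toRingHom] W} {g : W →ₛₗ[χ.toRingHom] U} (hf : MatchesBasis φ.toRingHom f)
    (hg : MatchesBasis χ.toRingHom g) (c : Constr) :
    ∀ t, map.{u, y, w, z} (χ.comp φ) (g.comp f) c t
      = map.{v, y, x, z} χ g c (map.{u, v, w, x} φ f c t) := by
  induction c with
  | base => exact fun _ => rfl
  | sum a b iha ihb => exact fun t => Prod.ext (iha t.1) (ihb t.2)
  | tensor a b iha ihb =>
    intro t
    have ha : map (χ.comp φ) (g.comp f) a = (map χ g a).comp (map φ f a) := LinearMap.ext iha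
    have hb : map (χ.comp φ) (g.comp f) b = (map χ g b).comp (map φ f b) := LinearMap.ext ihb
    exact (congrArg₂ (fun p q => TensorProduct.map p q t) ha hb).trans
      (tensorMap_comp_apply _ _ _ _ t)
  | sym n a iha =>
    intro t
    have ha : map (χ.comp φ) (g.comp f) a = (map χ g a).comp (map φ f a) := LinearMap.ext iha
    exact (congrArg (fun p => symPowMap (χ.comp φ).toRingHom n p t) ha).trans
      (symPowMap_comp_apply n _ _ t)
  | ext n a iha =>
    intro t
    have ha : map (χ.comp φ) (g.comp f) a = (map χ g a).comp (map φ f a) := LinearMap.ext iha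
    exact (congrArg (fun p => exteriorPowerMap (χ.comp φ).toRingHom n p t) ha).trans
      (exteriorPowerMap_comp_apply n _ _ t)
  | dual a iha =>
    intro t
    have ha : map (χ.comp φ) (g.comp f) a = (map χ g a).comp (map φ f a) := LinearMap.ext iha
    exact (congrArg (fun p => dualMap (χ.comp φ).toRingHom p t) ha).trans
      (MatchesBasis.dualMap_comp_apply (matchesBasis_map χ hg a) (matchesBasis_map φ hf a) t)
  | prolong a iha => exact fun t => Prod.ext (iha t.1) (iha t.2)

end Constr

namespace Constr

/-- Compares the two sides of a commutative square, which are semilinear over ring maps that are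
only propositionally equal. -/
theorem map_congr {R : Type u} {S : Type v} [CommRing R] [Differential R] [CommRing S]
    [Differential S] {V : Type (max u w)} [AddCommGroup V] [Module R V] {W : Type (max v x)}
    [AddCommGroup W] [Module S W] {φ χ : DiffHom R S} (h : φ = χ) {f : V →ₛₗ[φ.toRingHom] W}
    {g : V →ₛₗ[χ.toRingHom] W} (hfg : ∀ m, f m = g m) (c : Constr) (t : obj.{u, w} R V c) :
    map.{u, v, w, x} φ f c t = map.{u, v, w, x} χ g c t := by
  subst h
  exact congrArg (fun p => map φ p c t) (LinearMap.ext hfg)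

end Constr

/-! ### Bases under extension of scalars -/

namespace BaseChange

variable {F : Type u} {L : Type v} [CommRing F] [CommRing L] (φ : F →+* L)
  {M : Type w} [AddCommGroup M] [Module F M]

/-- The basis `1 ⊗ bᵢ` of `L ⊗_F M`. -/
noncomputable def basis {ι : Type*} (b : Module.Basis ι F M) :
    Module.Basis ι L (BaseChange φ M) :=
  letI := φ.toAlgebra
  (b.baseChange L : Module.Basis ι L (L ⊗[F] M))

theorem incl_basis {ι : Type*} (b : Module.Basis ι F M) (i : ι) :
    incl φ M (b i) = basis φ b i := by
  let := φ.toAlgebra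
  exact (b.baseChange_apply L i).symm

end BaseChange

theorem matchesBasis_incl {F : Type u} {L : Type v} [Field F] [CommRing L] (φ : F →+* L)
    (M : Type w) [AddCommGroup M] [Module F M] [Module.Finite F M] :
    MatchesBasis φ (BaseChange.incl φ M) :=
  .of_basis (Module.finBasis F M) (BaseChange.basis φ _) (BaseChange.incl_basis φ _)

/-! ### Comparison of Galois groups under an extension of difference-differential fields -/

namespace QDiffModule

/-- A linear form `ℓ` extends along the operator as `σ ∘ ℓ ∘ Sig⁻¹`. This brings the operator within
the scope of `Constr.map_comp_apply`. -/
theorem matchesBasis_Sig {F : Type u} [Field F] [Differential F] {σ : DiffHom F F}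
    (M : QDiffModule.{u, w} F σ) (hσ : Function.Bijective σ.toRingHom) :
    MatchesBasis σ.toRingHom M.Sig := by
  refine .of_extend ?_ fun ℓ => ?_
  · rw [M.bijective.2.range_eq]
    exact Submodule.span_univ
  · let e := Equiv.ofBijective _ M.bijective
    have he : ∀ m, e.symm (M.Sig m) = m := e.symm_apply_apply
    have he' : ∀ m, ∃ m', M.Sig m' = m := M.bijective.2
    refine ⟨{ toFun := fun m => σ.toRingHom (ℓ (e.symm m))
              map_add' := fun a b => ?_
              map_smul' := fun c a => ?_ }, fun m => congrArg (fun t => σ.toRingHom (ℓ t)) (he m)⟩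
    · obtain ⟨a, rfl⟩ := he' a
      obtain ⟨b, rfl⟩ := he' b
      rw [← map_add, he, he, he, map_add, map_add]
    · obtain ⟨a, rfl⟩ := he' a
      obtain ⟨c, rfl⟩ := hσ.2 c
      rw [← map_smulₛₗ, he, he, map_smul, smul_eq_mul, map_mul, RingHom.id_apply, smul_eq_mul]

section Extension

variable {F : Type u} {L : Type v} [Field F] [Differential F] [Field L] [Differential L]
  {σ : DiffHom F F} {τ : DiffHom L L} {M : QDiffModule.{u, w} F σ} {N : QDiffModule.{v, w} L τ}
  {φ : DiffHom F L} {j : M.carrier →ₛₗ[φ.toRingHom] N.carrier}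
  {R : Type y} [CommRing R] [Differential R] {ψ : DiffHom L R} {V : Type (max y x)}
  [AddCommGroup V] [Module R V] {k : N.carrier →ₛₗ[ψ.toRingHom] V}

/-- Both composites are `c` applied to one semilinear map, since `j` commutes with the operators on
`M` and `N`. -/
theorem map_map_Sig (hσ : Function.Bijective σ.toRingHom) (hτ : Function.Bijective τ.toRingHom)
    (hφ : τ.comp φ = φ.comp σ) (hj : MatchesBasis φ.toRingHom j)
    (hjS : ∀ m, N.Sig (j m) = j (M.Sig m)) (c : Constr) (t : c.obj F M.carrier) :
    Constr.map τ N.Sig c (Constr.map φ j c t) = Constr.map φ j c (Constr.map σ M.Sig c t) := by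
  rw [← Constr.map_comp_apply φ τ hj (N.matchesBasis_Sig hτ) c t,
    ← Constr.map_comp_apply σ φ (M.matchesBasis_Sig hσ) hj c t]
  exact Constr.map_congr hφ hjS c t

/-- Submodules of the constructions of `M` generate submodules of the constructions of `L ⊗ M`,
so that the group of `L ⊗ M` stabilizes them. -/
theorem gal_le_gal (hσ : Function.Bijective σ.toRingHom) (hτ : Function.Bijective τ.toRingHom)
    (hφ : τ.comp φ = φ.comp σ) (hj : MatchesBasis φ.toRingHom j)
    (hjS : ∀ m, N.Sig (j m) = j (M.Sig m)) (hk : MatchesBasis ψ.toRingHom k) :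
    N.gal ψ k ≤ M.gal (ψ.comp φ) (k.comp j) := by
  intro g hg c P hP
  have hsub : N.IsSub c (Submodule.span L (Constr.map φ j c '' P)) := by
    intro n hn
    induction hn using Submodule.span_induction with
    | mem n hn =>
      obtain ⟨p, hp, rfl⟩ := hn
      rw [map_map_Sig hσ hτ hφ hj hjS]
      exact Submodule.subset_span ⟨_, hP p hp, rfl⟩
    | zero => rw [map_zero]; exact Submodule.zero_mem _
    | add a b _ _ ha hb => rw [map_add]; exact Submodule.add_mem _ ha hb
    | smul s a _ ha => rw [map_smulₛₗ]; exact Submodule.smul_mem _ _ ha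
  -- Extending `P` to `R` directly or through `L` gives the same submodule.
  have heq : N.extend ψ k c (Submodule.span L (Constr.map φ j c '' P))
      = M.extend (ψ.comp φ) (k.comp j) c P := by
    refine le_antisymm (Submodule.span_le.2 ?_) (Submodule.span_le.2 ?_)
    · rintro _ ⟨n, hn, rfl⟩
      induction hn using Submodule.span_induction with
      | mem n hn =>
        obtain ⟨p, hp, rfl⟩ := hn
        exact Submodule.subset_span ⟨p, hp, Constr.map_comp_apply φ ψ hj hk c p⟩
      | zero => rw [map_zero]; exact Submodule.zero_mem _
      | add a b _ _ ha hb => rw [map_add]; exact Submodule.add_mem _ ha hb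
      | smul s a _ ha => rw [map_smulₛₗ]; exact Submodule.smul_mem _ _ ha
    · rintro _ ⟨p, hp, rfl⟩
      exact Submodule.subset_span ⟨_, Submodule.subset_span ⟨p, hp, rfl⟩,
        (Constr.map_comp_apply φ ψ hj hk c p).symm⟩
  rw [← heq]
  exact hg c _ hsub

/-- It suffices to check that a subgroup of `GL(V)` maps each `N ⊗ R` into itself. -/
theorem le_gal_of_mapsTo {G : Subgroup (V ≃ₗ[R] V)} (h : ∀ g ∈ G, ∀ (c : Constr)
      (P : Submodule L (c.obj L N.carrier)), N.IsSub c P → ∀ n ∈ P,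
      Constr.map (DiffHom.id R) (g : V →ₗ[R] V) c (Constr.map ψ k c n) ∈ N.extend ψ k c P) :
    G ≤ N.gal ψ k := by
  have hle : ∀ g ∈ G, ∀ (c : Constr) (P : Submodule L (c.obj L N.carrier)), N.IsSub c P →
      (N.extend ψ k c P).map (Constr.map (DiffHom.id R) (g : V →ₗ[R] V) c)
        ≤ N.extend ψ k c P := fun g hg c P hP => by
    rw [extend, Submodule.map_span_le]
    rintro _ ⟨n, hn, rfl⟩
    exact h g hg c P hP n hn
  intro g hg c P hP
  -- The opposite inclusion is the same one for `g⁻¹ ∈ G`.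
  refine le_antisymm (hle g hg c P hP) fun t ht => ?_
  have e := (Constr.map_id_mul (V := V) (R := R) c).2 g g⁻¹
  rw [mul_inv_cancel] at e
  have e' := e.symm.trans (Constr.map_id_mul (V := V) (R := R) c).1
  exact ⟨_, hle g⁻¹ (inv_mem hg) c P hP ⟨t, ht, rfl⟩, LinearMap.congr_fun e' t⟩

/-! ### Elements reached by morphisms from constructions of `M` -/

variable (M j k) in
/-- The element `y` of the construction `c(N)` is in the image of a morphism `c'(M) → c(N)` of
`q`-difference modules which extends to a `GL(V)`-equivariant map `c'(V) → c(V)`. -/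
def IsReached (c : Constr) (y : c.obj L N.carrier) : Prop :=
  ∃ (c' : Constr) (Φ : c'.obj F M.carrier →ₛₗ[φ.toRingHom] c.obj L N.carrier)
    (Ψ : c'.obj R V →ₗ[R] c.obj R V),
    (∀ t, Constr.map τ N.Sig c (Φ t) = Φ (Constr.map σ M.Sig c' t)) ∧
    (∀ (g : V ≃ₗ[R] V) t, Constr.map (DiffHom.id R) (g : V →ₗ[R] V) c (Ψ t)
      = Ψ (Constr.map (DiffHom.id R) (g : V →ₗ[R] V) c' t)) ∧
    (∀ t, Ψ (Constr.map (ψ.comp φ) (k.comp j) c' t) = Constr.map ψ k c (Φ t)) ∧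
    ∃ t, Φ t = y

/-- The preimage of `P` in `c'(M)` is a sub-`q`-difference module, so `g` preserves its extension to
`R`; the equivariant map `Ψ` carries this into `P ⊗ R`. -/
theorem IsReached.map_mem {c : Constr} {y : c.obj L N.carrier} (hy : M.IsReached j k c y)
    {g : V ≃ₗ[R] V} (hg : g ∈ M.gal (ψ.comp φ) (k.comp j))
    {P : Submodule L (c.obj L N.carrier)} (hP : N.IsSub c P) (hyP : y ∈ P) :
    Constr.map (DiffHom.id R) (g : V →ₗ[R] V) c (Constr.map ψ k c y) ∈ N.extend ψ k c P := by
  obtain ⟨c', Φ, Ψ, hΦ, hΨ, hc, t, rfl⟩ := hy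
  have hsub : M.IsSub c' (P.comap Φ) := fun m hm => by
    rw [Submodule.mem_comap, ← hΦ]
    exact hP _ hm
  have hmem : Constr.map (DiffHom.id R) (g : V →ₗ[R] V) c' (Constr.map (ψ.comp φ) (k.comp j) c' t)
      ∈ M.extend (ψ.comp φ) (k.comp j) c' (P.comap Φ) := by
    rw [← hg c' _ hsub]
    exact ⟨_, Submodule.subset_span ⟨t, hyP, rfl⟩, rfl⟩
  rw [← hc, hΨ]
  have hle : (M.extend (ψ.comp φ) (k.comp j) c' (P.comap Φ)).map Ψ ≤ N.extend ψ k c P := by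
    rw [extend, Submodule.map_span_le]
    rintro _ ⟨m, hm, rfl⟩
    rw [hc]
    exact Submodule.subset_span ⟨_, hm, rfl⟩
  exact hle ⟨_, hmem, rfl⟩

/-- The sum of the two morphisms is defined on the direct sum of their sources, which is again a
construction. -/
theorem IsReached.add {c : Constr} {y z : c.obj L N.carrier} (hy : M.IsReached j k c y)
    (hz : M.IsReached j k c z) : M.IsReached j k c (y + z) := by
  obtain ⟨c₁, Φ₁, Ψ₁, hΦ₁, hΨ₁, hc₁, t₁, rfl⟩ := hy
  obtain ⟨c₂, Φ₂, Ψ₂, hΦ₂, hΨ₂, hc₂, t₂, rfl⟩ := hz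
  let Φ : (c₁.obj F M.carrier × c₂.obj F M.carrier) →ₛₗ[φ.toRingHom] c.obj L N.carrier :=
    { toFun := fun t => Φ₁ t.1 + Φ₂ t.2
      map_add' := fun s t => by
        rw [Prod.fst_add, Prod.snd_add, map_add, map_add]; abel
      map_smul' := fun a t => by
        rw [Prod.smul_fst, Prod.smul_snd, map_smulₛₗ, map_smulₛₗ, smul_add] }
  refine ⟨.sum c₁ c₂, Φ, Ψ₁.coprod Ψ₂, fun t => ?_, fun g t => ?_, fun t => ?_, (t₁, t₂), rfl⟩
  · exact (map_add _ _ _).trans (congrArg₂ (· + ·) (hΦ₁ t.1) (hΦ₂ t.2))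
  · refine (congrArg _ (LinearMap.coprod_apply Ψ₁ Ψ₂ t)).trans ((map_add _ _ _).trans ?_)
    exact congrArg₂ (· + ·) (hΨ₁ g t.1) (hΨ₂ g t.2)
  · refine (LinearMap.coprod_apply Ψ₁ Ψ₂ _).trans (Eq.trans ?_ (map_add _ _ _).symm)
    exact congrArg₂ (· + ·) (hc₁ t.1) (hc₂ t.2)

/-- A `τ`-invariant scalar may multiply the morphism itself without spoiling its compatibility with
the operators. -/
theorem IsReached.smul_const {c : Constr} {y : c.obj L N.carrier} (hy : M.IsReached j k c y)
    {a : L} (ha : τ.toRingHom a = a) : M.IsReached j k c (a • y) := by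
  obtain ⟨c', Φ, Ψ, hΦ, hΨ, hc, t, rfl⟩ := hy
  refine ⟨c', a • Φ, ψ.toRingHom a • Ψ, fun t => ?_, fun g t => ?_, fun t => ?_, t, rfl⟩
  · rw [LinearMap.smul_apply, LinearMap.smul_apply, map_smulₛₗ, ha, hΦ]
  · rw [LinearMap.smul_apply, LinearMap.smul_apply, ← hΨ]
    exact map_smul _ _ _
  · rw [LinearMap.smul_apply, LinearMap.smul_apply, map_smulₛₗ, hc]

/-- A scalar coming from `F`, constant or not, is absorbed into the preimage; the morphism is
unchanged. -/
theorem IsReached.smul_map {c : Constr} {y : c.obj L N.carrier} (hy : M.IsReached j k c y)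
    (a : F) : M.IsReached j k c (φ.toRingHom a • y) := by
  obtain ⟨c', Φ, Ψ, hΦ, hΨ, hc, t, rfl⟩ := hy
  exact ⟨c', Φ, Ψ, hΦ, hΨ, hc, a • t, map_smulₛₗ Φ a t⟩

theorem isReached_map (hσ : Function.Bijective σ.toRingHom)
    (hτ : Function.Bijective τ.toRingHom) (hφ : τ.comp φ = φ.comp σ)
    (hj : MatchesBasis φ.toRingHom j) (hjS : ∀ m, N.Sig (j m) = j (M.Sig m))
    (hk : MatchesBasis ψ.toRingHom k) (c : Constr) (t : c.obj F M.carrier) :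
    M.IsReached j k c (Constr.map φ j c t) :=
  ⟨c, Constr.map φ j c, LinearMap.id, map_map_Sig hσ hτ hφ hj hjS c, fun _ _ => rfl,
    Constr.map_comp_apply φ ψ hj hk c, t, rfl⟩

end Extension

/-! ### Extending the constants of a rational function field -/

section RatFunc

open Polynomial

variable {K : Type u} {L : Type v} [Field K] [Field L] {σ : DiffHom (RatFunc K) (RatFunc K)}
  {τ : DiffHom (RatFunc L) (RatFunc L)} {M : QDiffModule.{u, w} (RatFunc K) σ}
  {N : QDiffModule.{v, w} (RatFunc L) τ} {φ : DiffHom (RatFunc K) (RatFunc L)}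
  {j : M.carrier →ₛₗ[φ.toRingHom] N.carrier} {R : Type y} [CommRing R] [Differential R]
  {ψ : DiffHom (RatFunc L) R} {V : Type (max y x)} [AddCommGroup V] [Module R V]
  {k : N.carrier →ₛₗ[ψ.toRingHom] V}

theorem IsReached.smul_polynomial (hX : φ.toRingHom RatFunc.X = RatFunc.X)
    (hC : ∀ a, τ.toRingHom (RatFunc.C a) = RatFunc.C a) {c : Constr}
    {y : c.obj (RatFunc L) N.carrier} (hy : M.IsReached j k c y) (p : L[X]) :
    M.IsReached j k c (algebraMap L[X] (RatFunc L) p • y) := by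
  induction p using Polynomial.induction_on' with
  | add p q hp hq => rw [map_add, add_smul]; exact hp.add hq
  | monomial n a =>
    -- In `a xⁿ`, the power `xⁿ` comes from `K(x)` and `a` is invariant under `τ`, so each factor is
    -- covered by one of the two scalar rules.
    rw [← C_mul_X_pow_eq_monomial, map_mul, map_pow, RatFunc.algebraMap_C, RatFunc.algebraMap_X,
      mul_smul, ← hX, ← map_pow]
    exact (hy.smul_map _).smul_const (hC a)

/-- Images of `c(M)` generate `c(N)` over `L(x)`. The available scalars include `L[x]`, so it
remains to clear the denominators of the coefficients. -/
theorem exists_isReached_smul (hσ : Function.Bijective σ.toRingHom)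
    (hτ : Function.Bijective τ.toRingHom) (hφ : τ.comp φ = φ.comp σ)
    (hX : φ.toRingHom RatFunc.X = RatFunc.X) (hC : ∀ a, τ.toRingHom (RatFunc.C a) = RatFunc.C a)
    (hj : MatchesBasis φ.toRingHom j) (hjS : ∀ m, N.Sig (j m) = j (M.Sig m))
    (hk : MatchesBasis ψ.toRingHom k) (c : Constr) (y : c.obj (RatFunc L) N.carrier) :
    ∃ d : L[X], d ≠ 0 ∧ M.IsReached j k c (algebraMap L[X] (RatFunc L) d • y) := by
  have hy : y ∈ Submodule.span (RatFunc L) (Set.range (Constr.map φ j c)) := by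
    rw [(Constr.matchesBasis_map φ hj c).span_range]; trivial
  induction hy using Submodule.span_induction with
  | mem y hy =>
    obtain ⟨t, rfl⟩ := hy
    exact ⟨1, one_ne_zero, (isReached_map hσ hτ hφ hj hjS hk c t).smul_polynomial hX hC 1⟩
  | zero =>
    refine ⟨1, one_ne_zero, ?_⟩
    have h := isReached_map hσ hτ hφ hj hjS hk c 0
    rw [map_zero] at h
    rwa [smul_zero]
  | add y z _ _ hy hz =>
    obtain ⟨d, hd, hy⟩ := hy
    obtain ⟨e, he, hz⟩ := hz
    refine ⟨d * e, mul_ne_zero hd he, ?_⟩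
    rw [smul_add]
    nth_rewrite 1 [mul_comm d e]
    rw [map_mul, map_mul, mul_smul, mul_smul]
    exact (hy.smul_polynomial hX hC e).add (hz.smul_polynomial hX hC d)
  | smul f y _ hy =>
    obtain ⟨d, hd, hy⟩ := hy
    refine ⟨d * f.denom, mul_ne_zero hd f.denom_ne_zero, ?_⟩
    have h : algebraMap L[X] (RatFunc L) (d * f.denom) • f • y
        = algebraMap L[X] (RatFunc L) f.num • algebraMap L[X] (RatFunc L) d • y := by
      have hf : algebraMap L[X] (RatFunc L) f.denom * f = algebraMap L[X] (RatFunc L) f.num := by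
        have := f.num_div_denom
        rw [div_eq_iff (RatFunc.algebraMap_ne_zero f.denom_ne_zero)] at this
        rw [this, mul_comm]
      rw [smul_smul, smul_smul, map_mul, mul_assoc, hf, mul_comm]
    rw [h]
    exact hy.smul_polynomial hX hC f.num

/-- The parameterized generic Galois group is compatible with extensions of the field of constants:
a sub-`q`-difference module `P` of `c(L(x) ⊗ M)` is generated by images of sub-`q`-difference
modules of the constructions `c(M)ⁿ`, under morphisms `(vᵢ) ↦ ∑ aᵢ vᵢ` with `aᵢ ∈ L`. -/
theorem gal_eq_gal (hσ : Function.Bijective σ.toRingHom)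
    (hτ : Function.Bijective τ.toRingHom) (hφ : τ.comp φ = φ.comp σ)
    (hX : φ.toRingHom RatFunc.X = RatFunc.X) (hC : ∀ a, τ.toRingHom (RatFunc.C a) = RatFunc.C a)
    (hj : MatchesBasis φ.toRingHom j) (hjS : ∀ m, N.Sig (j m) = j (M.Sig m))
    (hk : MatchesBasis ψ.toRingHom k) :
    M.gal (ψ.comp φ) (k.comp j) = N.gal ψ k := by
  refine le_antisymm (le_gal_of_mapsTo fun g hg c P hP n hn => ?_)
    (gal_le_gal hσ hτ hφ hj hjS hk)
  obtain ⟨d, hd, h⟩ := exists_isReached_smul hσ hτ hφ hX hC hj hjS hk c n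
  -- The denominator is harmless: `d • n` still lies in `P`, and `ψ(d⁻¹)` undoes the multiplication
  -- inside the `R`-submodule `P ⊗ R`.
  have hmem := h.map_mem hg hP (P.smul_mem _ hn)
  have hd' := RatFunc.algebraMap_ne_zero hd
  have hn' : Constr.map (DiffHom.id R) (g : V →ₗ[R] V) c (Constr.map ψ k c n)
      = ψ.toRingHom (algebraMap L[X] (RatFunc L) d)⁻¹ •
        Constr.map (DiffHom.id R) (g : V →ₗ[R] V) c
          (Constr.map ψ k c (algebraMap L[X] (RatFunc L) d • n)) := by
    refine Eq.trans ?_ (map_smul (Constr.map (DiffHom.id R) (g : V →ₗ[R] V) c) _ _)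
    rw [← map_smulₛₗ, smul_smul, inv_mul_cancel₀ hd', one_smul]
  rw [hn']
  exact Submodule.smul_mem _ _ hmem

theorem ratFuncMap_X (ι : K →+* L) : (ratFuncMap ι).toRingHom RatFunc.X = RatFunc.X := by
  rw [← RatFunc.algebraMap_X, ratFuncMap, algebraMap_comp_mapRingHom]
  simp

theorem qShift_C (q : Lˣ) (a : L) : (qShift q).toRingHom (RatFunc.C a) = RatFunc.C a := by
  rw [← RatFunc.algebraMap_C, qShift, algebraMap_comp_mapRingHom]
  simp

variable {q : Kˣ} (M : QDiffModule.{u, w} (RatFunc K) (qShift q))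

theorem toOverField_Sig (ι : K →+* L) (m : M.carrier) :
    (M.overField ι).Sig (M.toOverField ι m) = M.toOverField ι (M.Sig m) :=
  BaseChange.desc_incl _ _ (congrArg DiffHom.toRingHom (qShift_comp_ratFuncMap ι q)) _ m

theorem matchesBasis_toOverField (ι : K →+* L) :
    MatchesBasis (ratFuncMap ι).toRingHom (M.toOverField ι) :=
  matchesBasis_incl _ _

/-! ### Towers of constant fields -/

section Tower

variable {K' : Type x} [Field K'] (ι : K →+* L) (ι' : K →+* K') (κ : K' →+* L)
  (h : κ.comp ι' = ι)

theorem overFieldMap_toOverField (m : M.carrier) :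
    M.overFieldMap ι ι' κ h (M.toOverField ι' m) = M.toOverField ι m :=
  BaseChange.desc_incl _ _ _ _ m

theorem matchesBasis_overFieldMap :
    MatchesBasis (ratFuncMap κ).toRingHom (M.overFieldMap ι ι' κ h) := by
  let b := Module.finBasis (RatFunc K) M.carrier
  refine .of_basis (BaseChange.basis (ratFuncMap ι').toRingHom b)
    (BaseChange.basis (ratFuncMap ι).toRingHom b) fun i => ?_
  exact (congrArg (M.overFieldMap ι ι' κ h) (BaseChange.incl_basis _ b i).symm).trans
    ((M.overFieldMap_toOverField ι ι' κ h (b i)).trans (BaseChange.incl_basis _ b i))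

/-- Both sides are semilinear over the same ring map, by the commutation of `q`-shifts with `K'(x) →
L(x)`, so agreement on the generating image of `M` suffices. -/
theorem overFieldMap_Sig (m : (M.overField ι').carrier) :
    (M.overField ι).Sig (M.overFieldMap ι ι' κ h m)
      = M.overFieldMap ι ι' κ h ((M.overField ι').Sig m) := by
  have hm : m ∈ Submodule.span (RatFunc K') (Set.range (M.toOverField ι')) := by
    rw [(M.matchesBasis_toOverField ι').span_range]; trivial
  have hcomp := qShift_comp_ratFuncMap κ (Units.map (ι' : K →* K') q)
  have hq : Units.map (κ : K' →* L) (Units.map (ι' : K →* K') q) = Units.map (ι : K →* L) q := by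
    ext
    exact RingHom.congr_fun h _
  rw [hq] at hcomp
  induction hm using Submodule.span_induction with
  | mem m hm =>
    obtain ⟨m, rfl⟩ := hm
    rw [overFieldMap_toOverField, toOverField_Sig, toOverField_Sig, overFieldMap_toOverField]
  | zero => simp only [map_zero]
  | add a b _ _ ha hb => simp only [map_add, ha, hb]
  | smul s a _ ha =>
    rw [map_smulₛₗ, map_smulₛₗ, map_smulₛₗ, map_smulₛₗ, ha]
    exact congrArg (· • _) (RingHom.congr_fun (congrArg DiffHom.toRingHom hcomp) s)

end Tower

end RatFunc

end QDiffModule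

/-- The parameterized generic Galois group of `M_{ℂ(x)}` is contained in that of `M_{K(x)}`. The
reverse inclusion holds over every field of constants between `K` and `ℂ`, by
`QDiffModule.gal_eq_gal`, so that `K' = K` is a field as required. -/
theorem mainTheorem8 (K : IntermediateField ℚ ℂ) (hK : K.FG) (q : (↥K)ˣ) (hq : q ≠ 1)
    (M : QDiffModule.{0, w} (RatFunc K) (qShift q)) :
    (∀ (R : Type v) [CommRing R] [Differential R] (ψ : DiffHom (RatFunc ℂ) R),
      (M.overField (algebraMap K ℂ)).galPoints ψ ≤
        M.galPointsOver (M.overField (algebraMap K ℂ)) (ratFuncMap (algebraMap K ℂ))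
          (M.toOverField (algebraMap K ℂ)) ψ) ∧
    ∃ K' : IntermediateField K ℂ, K'.FG ∧
      ∀ (R : Type v) [CommRing R] [Differential R] (ψ : DiffHom (RatFunc ℂ) R),
        (M.overField (algebraMap K K')).galPointsOver (M.overField (algebraMap K ℂ))
            (ratFuncMap (algebraMap K' ℂ))
            (M.overFieldMap (algebraMap K ℂ) (algebraMap K K') (algebraMap K' ℂ)
              (IsScalarTower.algebraMap_eq K K' ℂ).symm) ψ =
          (M.overField (algebraMap K ℂ)).galPoints ψ := by
  -- The witness `⊥` is the copy of `K` in `ℂ`, finitely generated over `K` by the empty set.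
  refine ⟨fun R _ _ ψ => ?_, ⊥, IntermediateField.fg_bot, fun R _ _ ψ => ?_⟩
  · exact QDiffModule.gal_le_gal (qShift_bijective q) (qShift_bijective _)
      (qShift_comp_ratFuncMap _ q) (M.matchesBasis_toOverField _) (M.toOverField_Sig _)
      (matchesBasis_incl _ _)
  · have hcomp := qShift_comp_ratFuncMap (algebraMap (⊥ : IntermediateField K ℂ) ℂ)
      (Units.map (algebraMap K (⊥ : IntermediateField K ℂ) : K →* _) q)
    exact QDiffModule.gal_eq_gal (qShift_bijective _) (qShift_bijective _) hcomp
      (QDiffModule.ratFuncMap_X _) (QDiffModule.qShift_C _)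
      (M.matchesBasis_overFieldMap _ _ _ _) (M.overFieldMap_Sig _ _ _ _)
      (matchesBasis_incl _ _)
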